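/- All graphs are finite and simple. For a graph $G$ let $m(G)$ be the largest integer $k$ such that at least $k$ vertices of $G$ have degree at least $k-1$; a vertex is dense if its degree is at least $m(G)-1$, and $G$ is tight if it has exactly $m(G)$ dense vertices and each of them has degree exactly $m(G)-1$. For a vertex set $X$, the outer boundary $\delta X$ is the set of vertices outside $X$ that have a neighbour in $X$. Colourings are proper and take values in $\mathbb{Z}^+$; a colouring $c$ is a b-colouring if every colour class contains a vertex that has a neighbour in every other colour class. Let $G$ be a tight graph with set $T$ of dense vertices and let $S'\subseteq\delta T$. An $S'$-partial b-colouring is a colouring $c'$ of $G[S'\cup T]$ such that (1) $c'(u)\ne c'(u')$ for distinct $u,u'\in T$, and (2) whenever $u\in T$ and $c'(u)=c'(s)$ for some $s\in S'$, every vertex of $T\setminus\{u\}$ has exactly one neighbour in $S'\cup T$ with colour $c'(u)$. A b-precolouring extension of $c'$ is a b-colouring $c$ of $G$ that agrees with $c'$ on $S'\cup T$ and such that every colour class of $c$ with at least two vertices of $\delta T$ contains no vertex of $\delta T\setminus S'$. Theorem. There is a polynomial-time algorithm that, given a tight graph $G$, a set $S'\subseteq\delta T$ and an $S'$-partial b-colouring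 $c'$ of $G$, decides whether $c'$ has a b-precolouring extension in $G$. Moreover, let $T_1$ be the set of $u\in T$ that are adjacent to all of $T\setminus\{u\}$, let $T'$ be the set of $u\in T$ that have the same colour as some vertex of $S'$, let $T_2=T\setminus(T_1\cup T')$, and let $G^*$ be the bipartite graph with partition classes $T_2$ and $\delta T\setminus S'$ in which $u\in T_2$ and $s\in\delta T\setminus S'$ are adjacent if and only if $us\notin E(G)$ and $u,s$ have no common neighbour in $(T_2\cup T')\setminus\{u\}$ in $G$. Then $c'$ has a b-precolouring extension in $G$ if and only if every colour that $c'$ uses on $S'$ is also used on $T$ and $G^*$ has a perfect matching. -/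

import Mathlib

/-! ### b-colourings of finite simple graphs -/

namespace BCol

universe u

variable {V : Type u}

/-- The degree of a vertex of a (finite) graph: the number of its neighbours. -/
noncomputable def deg (G : SimpleGraph V) (v : V) : ℕ := (G.neighborSet v).ncard

/-- The `m`-degree: the largest `k` such that at least `k` vertices have degree at least `k - 1`
(for finite `V` the set below contains `0` and is bounded by the number of vertices). -/
noncomputable def mDegree (G : SimpleGraph V) : ℕ :=
  sSup {k : ℕ | k ≤ {v : V | k ≤ deg G v + 1}.ncard}

/-- The set of dense vertices, i.e. of those of degree at least `m(G) - 1`. -/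
def denseSet (G : SimpleGraph V) : Set V := {v | mDegree G ≤ deg G v + 1}

/-- `G` is tight: it has exactly `m(G)` dense vertices, each of degree exactly `m(G) - 1`. -/
def IsTight (G : SimpleGraph V) : Prop :=
  (denseSet G).ncard = mDegree G ∧ ∀ v ∈ denseSet G, deg G v + 1 = mDegree G

/-- The outer boundary of a set `S` of vertices: the vertices outside `S` with a neighbour
in `S`. -/
def outerBoundary (G : SimpleGraph V) (S : Set V) : Set V :=
  (⋃ u ∈ S, G.neighborSet u) \ S

/-- `v` is b-chromatic under `c`: it has a neighbour in every colour class of `c` but its own. -/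
def IsBChromatic {G : SimpleGraph V} (c : G.Coloring ℕ+) (v : V) : Prop :=
  ∀ j ∈ Set.range c, j ≠ c v → ∃ w, G.Adj v w ∧ c w = j

/-- A b-colouring: every (nonempty) colour class contains a b-chromatic vertex. -/
def IsBColouring {G : SimpleGraph V} (c : G.Coloring ℕ+) : Prop :=
  ∀ i ∈ Set.range c, ∃ v, c v = i ∧ IsBChromatic c v

/-- Colourings of `G[S' ∪ T]`, where `T` is the set of dense vertices of `G`. -/
abbrev PreColouring (G : SimpleGraph V) (S' : Set V) : Type u :=
  (G.induce (S' ∪ denseSet G)).Coloring ℕ+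

/-- The colouring `c'` of `G[S' ∪ T]` is an `S'`-partial b-colouring. -/
structure IsPartialBColouring (G : SimpleGraph V) (S' : Set V) (c' : PreColouring G S') :
    Prop where
  /-- Distinct dense vertices have distinct colours. -/
  injective_on_dense : ∀ u u' : ↥(S' ∪ denseSet G),
    (u : V) ∈ denseSet G → (u' : V) ∈ denseSet G → u ≠ u' → c' u ≠ c' u'
  /-- If a dense vertex `u` shares its colour with a vertex of `S'`, then every other dense vertex
  has exactly one neighbour with that colour. -/
  unique_neighbour : ∀ u : ↥(S' ∪ denseSet G), (u : V) ∈ denseSet G →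
    (∃ s : ↥(S' ∪ denseSet G), (s : V) ∈ S' ∧ c' u = c' s) →
    ∀ w ∈ denseSet G, w ≠ (u : V) →
      ∃! x : ↥(S' ∪ denseSet G), G.Adj w (x : V) ∧ c' x = c' u

/-- The colouring `c` of `G` is a b-precolouring extension of `c'`. -/
structure IsBPrecolouringExtension (G : SimpleGraph V) (S' : Set V) (c' : PreColouring G S')
    (c : G.Coloring ℕ+) : Prop where
  isBColouring : IsBColouring c
  extends_pre : ∀ v : ↥(S' ∪ denseSet G), c (v : V) = c' v
  /-- A colour class with at least two vertices of `δT` contains no vertex of `δT \ S'`. -/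
  boundary_class : ∀ i : ℕ+,
    2 ≤ (c.colorClass i ∩ outerBoundary G (denseSet G)).ncard →
    Disjoint (c.colorClass i) (outerBoundary G (denseSet G) \ S')

/-- `c'` has a b-precolouring extension in `G`. -/
def HasBPrecolouringExtension (G : SimpleGraph V) (S' : Set V) (c' : PreColouring G S') : Prop :=
  ∃ c : G.Coloring ℕ+, IsBPrecolouringExtension G S' c' c

/-! ### The auxiliary bipartite graph -/

/-- `T₁`: the dense vertices that are dominating vertices of `G[T]`. -/
def T₁ (G : SimpleGraph V) : Set V :=
  {u | u ∈ denseSet G ∧ ∀ w ∈ denseSet G, w ≠ u → G.Adj w u}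

/-- `T'`: the dense vertices that have the same colour as some vertex of `S'`. -/
def T' (G : SimpleGraph V) (S' : Set V) (c' : PreColouring G S') : Set V :=
  {v | ∃ u s : ↥(S' ∪ denseSet G),
    (u : V) = v ∧ v ∈ denseSet G ∧ (s : V) ∈ S' ∧ c' u = c' s}

/-- `T₂ = T \ (T₁ ∪ T')`. -/
def T₂ (G : SimpleGraph V) (S' : Set V) (c' : PreColouring G S') : Set V :=
  denseSet G \ (T₁ G ∪ T' G S' c')

/-- The auxiliary bipartite graph with partition classes `T₂` and `δT \ S'`: here `u ∈ T₂` is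
joined to `s ∈ δT \ S'` iff they are not adjacent in `G` and have no common neighbour
in `(T₂ ∪ T') \ {u}`. -/
def auxGraph (G : SimpleGraph V) (S' : Set V) (c' : PreColouring G S') :
    SimpleGraph (↥(T₂ G S' c') ⊕ ↥(outerBoundary G (denseSet G) \ S')) :=
  SimpleGraph.fromRel fun x y =>
    ∃ (u : ↥(T₂ G S' c')) (s : ↥(outerBoundary G (denseSet G) \ S')),
      x = Sum.inl u ∧ y = Sum.inr s ∧ ¬ G.Adj (u : V) (s : V) ∧
      ∀ w ∈ (T₂ G S' c' ∪ T' G S' c') \ {(u : V)},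
        ¬ (G.Adj (u : V) w ∧ G.Adj (s : V) w)

end BCol

/-! ### Polynomial time on random access machines

Structured programs for a random access machine with registers and arrays of natural numbers.
The arithmetic operations are addition and truncated subtraction (no multiplication), and every
elementary instruction and every test costs one step. As no multiplication is available, a number
grows by at most one bit per step, so polynomial time in this model coincides with polynomial time
on Turing machines. -/

namespace RAM

/-- Programs. Registers and arrays are named by natural numbers fixed in the program text. -/
inductive Prog : Type
  /-- do nothing -/
  | skip : Prog
  /-- `x := k` for a constant `k` -/
  | const (x k : ℕ) : Prog
  /-- `x := y` -/
  | copy (x y : ℕ) : Prog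
  /-- `x := y + z` -/
  | add (x y z : ℕ) : Prog
  /-- `x := max (y - z) 0` -/
  | sub (x y z : ℕ) : Prog
  /-- `x := a[i]`, where the index is the content of register `i` -/
  | load (x a i : ℕ) : Prog
  /-- `a[i] := x`, where the index is the content of register `i` -/
  | store (a i x : ℕ) : Prog
  /-- first `p`, then `q` -/
  | seq (p q : Prog) : Prog
  /-- if `x ≠ 0` then `p` else `q` -/
  | branch (x : ℕ) (p q : Prog) : Prog
  /-- while `x ≠ 0` do `p` -/
  | loop (x : ℕ) (p : Prog) : Prog

/-- Memory states: the contents of the registers and of the cells of the arrays. -/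
@[ext]
structure State : Type where
  reg : ℕ → ℕ
  arr : ℕ → ℕ → ℕ

/-- Write `n` into register `x`. -/
def State.setReg (s : State) (x n : ℕ) : State :=
  { s with reg := Function.update s.reg x n }

/-- Write `n` into cell `i` of array `a`. -/
def State.setArr (s : State) (a i n : ℕ) : State :=
  { s with arr := Function.update s.arr a (Function.update (s.arr a) i n) }

/-- `Exec p s t s'`: started in the state `s`, the program `p` terminates after exactly `t` steps
in the state `s'`. -/
inductive Exec : Prog → State → ℕ → State → Prop
  | skip (s : State) : Exec Prog.skip s 1 s
  | const (s : State) (x k : ℕ) : Exec (Prog.const x k) s 1 (s.setReg x k)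
  | copy (s : State) (x y : ℕ) : Exec (Prog.copy x y) s 1 (s.setReg x (s.reg y))
  | add (s : State) (x y z : ℕ) : Exec (Prog.add x y z) s 1 (s.setReg x (s.reg y + s.reg z))
  | sub (s : State) (x y z : ℕ) : Exec (Prog.sub x y z) s 1 (s.setReg x (s.reg y - s.reg z))
  | load (s : State) (x a i : ℕ) : Exec (Prog.load x a i) s 1 (s.setReg x (s.arr a (s.reg i)))
  | store (s : State) (a i x : ℕ) :
      Exec (Prog.store a i x) s 1 (s.setArr a (s.reg i) (s.reg x))
  | seq {p q : Prog} {s s' s'' : State} {t t' : ℕ} (hp : Exec p s t s') (hq : Exec q s' t' s'') :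
      Exec (Prog.seq p q) s (t + t') s''
  | branch_pos {x : ℕ} {p q : Prog} {s s' : State} {t : ℕ} (hx : s.reg x ≠ 0)
      (hp : Exec p s t s') : Exec (Prog.branch x p q) s (t + 1) s'
  | branch_zero {x : ℕ} {p q : Prog} {s s' : State} {t : ℕ} (hx : s.reg x = 0)
      (hq : Exec q s t s') : Exec (Prog.branch x p q) s (t + 1) s'
  | loop_pos {x : ℕ} {p : Prog} {s s' s'' : State} {t t' : ℕ} (hx : s.reg x ≠ 0)
      (hp : Exec p s t s') (hl : Exec (Prog.loop x p) s' t' s'') :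
      Exec (Prog.loop x p) s (t + t' + 1) s''
  | loop_zero {x : ℕ} {p : Prog} {s : State} (hx : s.reg x = 0) : Exec (Prog.loop x p) s 1 s

/-- The initial state on the input `l`: register `0` holds the length of `l`, array `0` holds the
entries of `l`, and everything else is `0`. -/
def initState (l : List ℕ) : State where
  reg := fun x => if x = 0 then l.length else 0
  arr := fun a i => if a = 0 then l.getD i 0 else 0

/-- The size of an input: the total length of its entries written in binary, each one followed by
a separator. -/
def inputSize (l : List ℕ) : ℕ := (l.map fun a => Nat.size a + 1).sum

/-- The property `P` of instances, presented to the machine through the encoding `enc`, is decidable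
in polynomial time: one program halts on every instance within a number of steps that is bounded by
a fixed polynomial in the input size, leaving `1` in register `0` if `P` holds
and `0` if it does not. -/
def DecidableInPolyTime {α : Type*} (enc : α → List ℕ) (P : α → Prop) : Prop :=
  ∃ (prog : Prog) (b : Polynomial ℕ), ∀ a : α, ∃ (t : ℕ) (s : State),
    Exec prog (initState (enc a)) t s ∧ t ≤ b.eval (inputSize (enc a)) ∧
    (P a → s.reg 0 = 1) ∧ (¬ P a → s.reg 0 = 0)

end RAM

namespace BCol

/-- An instance of the decision problem: a tight graph on the vertices `0, …, n - 1`, a subset `S'`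
of the outer boundary of its set of dense vertices, and an `S'`-partial b-colouring. -/
structure Instance : Type where
  n : ℕ
  G : SimpleGraph (Fin n)
  S' : Set (Fin n)
  c' : PreColouring G S'
  isTight : IsTight G
  subset_boundary : S' ⊆ outerBoundary G (denseSet G)
  isPartial : IsPartialBColouring G S' c'

open Classical in
/-- The input that describes an instance: the number of vertices, the adjacency matrix row by row,
the indicator vector of `S'`, and the vector of the colours of the vertices under `c'`,
with entry `0` for the uncoloured vertices. -/
noncomputable def Instance.encode (I : Instance) : List ℕ :=
  [I.n]
  ++ (List.finRange I.n).flatMap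
      (fun i => (List.finRange I.n).map fun j => if I.G.Adj i j then 1 else 0)
  ++ (List.finRange I.n).map (fun v => if v ∈ I.S' then 1 else 0)
  ++ (List.finRange I.n).map
      (fun v => if h : v ∈ I.S' ∪ denseSet I.G then (I.c' ⟨v, h⟩ : ℕ) else 0)

/-- The question asked about an instance. -/
def Instance.HasExtension (I : Instance) : Prop :=
  HasBPrecolouringExtension I.G I.S' I.c'

end BCol

/-! Write m for m(G). A b-chromatic vertex of a b-colouring with k colours has degree at least k -
1, so k ≤ m. An extension of c' already shows m colours on T, hence it has exactly m. Every
b-chromatic vertex is then dense, so each dense vertex is the b-chromatic vertex of its own colour.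
Having only m - 1 neighbours, it sees every other colour exactly once
(`IsBColouring.dense_of_injOn`).

Necessity: a vertex u of T₂ has a non-neighbour w in T, and w must see the colour of u on a vertex s
of δT. As u is not in T', s is not in S', and the boundary condition makes s unique. This pairs T₂
with δT \ S'. Since no dense vertex sees a colour twice, u and s have no common dense neighbour.

Sufficiency: give each s the colour of its partner. No dense vertex then sees a colour twice, so by
counting it sees all colours but its own. Vertices of T₁ need no condition, because all their
neighbours lie in T. The remaining vertices have degree below m - 1 and are coloured greedily from
the same m colours.

Algorithm: since T can be read off as the coloured vertices outside S', adjacency in G* and the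
colour condition are formulas with quantifiers over the n vertices. A small language of n-fold sums
and repetitions expresses them and compiles to machine programs of polynomial cost. The matching is
found by an auction. If a perfect matching exists, an unassigned bidder is always joined to an item
cheaper than the number of items (`Auction.Inv.exists_price_lt`). So prices stay at most n, while
each round with an unassigned bidder raises their sum by one, and n² + 1 rounds settle the question.
-/

namespace BCol

universe u

variable {V : Type u}

/-- The relation that defines the edges of `auxGraph`. -/
def AuxAdj (G : SimpleGraph V) (S' : Set V) (c' : PreColouring G S') (u s : V) : Prop :=
  ¬ G.Adj u s ∧ ∀ w ∈ (T₂ G S' c' ∪ T' G S' c') \ {u}, ¬ (G.Adj u w ∧ G.Adj s w)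

/-! ### Perfect matchings of the auxiliary graph as bijections -/

section Matching

variable {G : SimpleGraph V} {S' : Set V} {c' : PreColouring G S'}

theorem auxGraph_adj_inl {u : ↥(T₂ G S' c')}
    {y : ↥(T₂ G S' c') ⊕ ↥(outerBoundary G (denseSet G) \ S')} :
    (auxGraph G S' c').Adj (Sum.inl u) y ↔ ∃ s, y = Sum.inr s ∧ AuxAdj G S' c' u s := by
  simp only [auxGraph, SimpleGraph.fromRel_adj, AuxAdj]
  constructor
  · rintro ⟨-, ⟨u', s, hu, rfl, h⟩ | ⟨u', s, -, h, -⟩⟩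
    · cases hu
      exact ⟨s, rfl, h⟩
    · cases h
  · rintro ⟨s, rfl, h⟩
    exact ⟨by simp, Or.inl ⟨u, s, rfl, rfl, h⟩⟩

theorem auxGraph_adj_inr {s : ↥(outerBoundary G (denseSet G) \ S')}
    {y : ↥(T₂ G S' c') ⊕ ↥(outerBoundary G (denseSet G) \ S')} :
    (auxGraph G S' c').Adj (Sum.inr s) y ↔ ∃ u, y = Sum.inl u ∧ AuxAdj G S' c' u s := by
  simp only [auxGraph, SimpleGraph.fromRel_adj, AuxAdj]
  constructor
  · rintro ⟨-, ⟨u', s, h, -, -⟩ | ⟨u', s', rfl, hs, h⟩⟩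
    · cases h
    · cases hs
      exact ⟨u', rfl, h⟩
  · rintro ⟨u, rfl, h⟩
    exact ⟨by simp, Or.inr ⟨u, s, rfl, rfl, h⟩⟩

theorem exists_isPerfectMatching_auxGraph_iff :
    (∃ M : (auxGraph G S' c').Subgraph, M.IsPerfectMatching) ↔
      ∃ f : ↥(T₂ G S' c') → ↥(outerBoundary G (denseSet G) \ S'),
        Function.Bijective f ∧ ∀ u : ↥(T₂ G S' c'), AuxAdj G S' c' u (f u) := by
  constructor
  · rintro ⟨M, hM⟩
    rw [SimpleGraph.Subgraph.isPerfectMatching_iff] at hM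
    have key : ∀ u, ∃ s, M.Adj (Sum.inl u) (Sum.inr s) ∧ AuxAdj G S' c' u s := by
      intro u
      obtain ⟨y, hy, -⟩ := hM (Sum.inl u)
      obtain ⟨s, rfl, h⟩ := auxGraph_adj_inl.1 hy.adj_sub
      exact ⟨s, hy, h⟩
    choose f hf hadj using key
    refine ⟨f, ⟨fun u u' h => ?_, fun s => ?_⟩, hadj⟩
    · have h₁ := (hf u).symm
      have h₂ := (hf u').symm
      rw [← h] at h₂
      exact Sum.inl_injective ((hM _).unique h₁ h₂)
    · obtain ⟨y, hy, -⟩ := hM (Sum.inr s)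
      obtain ⟨u, rfl, -⟩ := auxGraph_adj_inr.1 hy.adj_sub
      exact ⟨u, Sum.inr_injective ((hM _).unique (hf u) hy.symm)⟩
  · rintro ⟨f, hf, hadj⟩
    let M : (auxGraph G S' c').Subgraph :=
      { verts := Set.univ
        Adj := fun x y => ∃ u, (x = Sum.inl u ∧ y = Sum.inr (f u)) ∨
          (y = Sum.inl u ∧ x = Sum.inr (f u))
        adj_sub := by
          rintro x y ⟨u, ⟨rfl, rfl⟩ | ⟨rfl, rfl⟩⟩
          · exact auxGraph_adj_inl.2 ⟨_, rfl, hadj u⟩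
          · exact auxGraph_adj_inr.2 ⟨_, rfl, hadj u⟩
        edge_vert := fun _ => Set.mem_univ _
        symm := ⟨fun x y ⟨u, h⟩ => ⟨u, h.symm⟩⟩ }
    refine ⟨M, SimpleGraph.Subgraph.isPerfectMatching_iff.2 ?_⟩
    rintro (u | s)
    · refine ⟨Sum.inr (f u), ⟨u, Or.inl ⟨rfl, rfl⟩⟩, ?_⟩
      rintro y ⟨u', ⟨h, rfl⟩ | ⟨rfl, h⟩⟩
      · cases h; rfl
      · cases h
    · obtain ⟨u, rfl⟩ := hf.2 s
      refine ⟨Sum.inl u, ⟨u, Or.inr ⟨rfl, rfl⟩⟩, ?_⟩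
      rintro y ⟨u', ⟨h, rfl⟩ | ⟨rfl, h⟩⟩
      · cases h
      · rw [hf.1 (Sum.inr_injective h)]

end Matching

/-! ### The m-degree and greedy colouring -/

section Degrees

variable {G : SimpleGraph V}

theorem le_mDegree [Finite V] {k : ℕ} (hk : k ≤ {v : V | k ≤ deg G v + 1}.ncard) :
    k ≤ mDegree G := by
  -- The supremum is meaningful only because the set is bounded, here by the number of vertices.
  refine le_csSup ⟨Nat.card V, ?_⟩ hk
  intro j hj
  exact le_trans hj (by rw [← Set.ncard_univ]; exact Set.ncard_le_ncard (Set.subset_univ _))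

theorem exists_adj_of_mem_outerBoundary {X : Set V} {s : V} (hs : s ∈ outerBoundary G X) :
    ∃ w ∈ X, G.Adj w s := by
  obtain ⟨h, -⟩ := hs
  simpa using h

theorem mem_outerBoundary {X : Set V} {w s : V} (hw : w ∈ X) (h : G.Adj w s) (hs : s ∉ X) :
    s ∈ outerBoundary G X :=
  ⟨Set.mem_biUnion hw h, hs⟩

/-- A proper partial colouring extends greedily when every uncoloured vertex has fewer neighbours
than there are colours. -/
theorem exists_greedy_extension [Finite V] (C : Set ℕ+) (W : Set V) (c₀ : V → ℕ+)
    (hmem : ∀ v ∈ W, c₀ v ∈ C) (hprop : ∀ v ∈ W, ∀ w ∈ W, G.Adj v w → c₀ v ≠ c₀ w)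
    (hdeg : ∀ v, v ∉ W → deg G v < C.ncard) :
    ∃ c : G.Coloring ℕ+, (∀ v, c v ∈ C) ∧ ∀ v ∈ W, c v = c₀ v := by
  classical
  induction h : (Wᶜ).ncard generalizing W c₀ with
  | zero =>
    have hW : W = Set.univ := by
      rw [Set.ncard_eq_zero] at h
      simpa using h
    subst hW
    exact ⟨SimpleGraph.Coloring.mk c₀ fun {v w} hvw => hprop v trivial w trivial hvw,
      fun v => hmem v trivial, fun v _ => rfl⟩
  | succ k ih =>
    obtain ⟨x, hx⟩ : (Wᶜ).Nonempty := by
      rw [← Set.ncard_pos]; omega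
    -- The values of `c₀` on uncoloured neighbours are avoided as well. They are meaningless, but
    -- the image still has at most `deg G x` elements.
    obtain ⟨i, hiC, hi⟩ : ∃ i ∈ C, i ∉ c₀ '' G.neighborSet x := by
      exact Set.exists_mem_notMem_of_ncard_lt_ncard
        (lt_of_le_of_lt Set.ncard_image_le (hdeg x hx)) (Set.toFinite _)
    have hne : ∀ v ∈ W, v ≠ x := fun v hv hvx => hx (hvx ▸ hv)
    obtain ⟨c, hcC, hc⟩ := ih (insert x W) (Function.update c₀ x i)
      (by
        rintro v (rfl | hv)
        · simpa
        · rw [Function.update_of_ne (hne v hv)]; exact hmem v hv)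
      (by
        rintro v (rfl | hv) w (rfl | hw) hvw
        · exact absurd hvw (G.loopless.irrefl _)
        · rw [Function.update_self, Function.update_of_ne (hne w hw)]
          exact fun h => hi ⟨w, hvw, h.symm⟩
        · rw [Function.update_self, Function.update_of_ne (hne v hv)]
          exact fun h => hi ⟨v, hvw.symm, h⟩
        · rw [Function.update_of_ne (hne v hv), Function.update_of_ne (hne w hw)]
          exact hprop v hv w hw hvw)
      (fun v hv => hdeg v fun h => hv (Set.mem_insert_of_mem _ h))
      (by
        have h1 : (insert x W)ᶜ = Wᶜ \ {x} := by
          ext v; simp only [Set.mem_compl_iff, Set.mem_insert_iff, Set.mem_sdiff,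
            Set.mem_singleton_iff]; tauto
        rw [h1, Set.ncard_sdiff_singleton_of_mem hx, h]; rfl)
    refine ⟨c, hcC, fun v hv => ?_⟩
    rw [hc v (Set.mem_insert_of_mem _ hv), Function.update_of_ne (hne v hv)]

end Degrees

/-! ### From an extension to a matching -/

section Necessity

variable [Finite V] {G : SimpleGraph V}

theorem IsBChromatic.ncard_range_le {c : G.Coloring ℕ+} {v : V} (h : IsBChromatic c v) :
    (Set.range c \ {c v}).ncard ≤ (c '' G.neighborSet v).ncard :=
  Set.ncard_le_ncard (fun j hj => by
    obtain ⟨w, hw, rfl⟩ := h j hj.1 hj.2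
    exact ⟨w, hw, rfl⟩) (Set.toFinite _)

theorem IsBChromatic.ncard_range_le_deg {c : G.Coloring ℕ+} {v : V} (h : IsBChromatic c v) :
    (Set.range c).ncard ≤ deg G v + 1 := by
  have h₁ := h.ncard_range_le
  have h₂ : (c '' G.neighborSet v).ncard ≤ deg G v := Set.ncard_image_le
  rw [Set.ncard_sdiff_singleton_of_mem (Set.mem_range_self v)] at h₁
  omega

/-- One b-chromatic vertex per colour gives as many vertices as colours, each of degree at least
that number minus one. -/
theorem IsBColouring.ncard_range_le_mDegree {c : G.Coloring ℕ+} (hc : IsBColouring c) :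
    (Set.range c).ncard ≤ mDegree G := by
  apply le_mDegree
  rcases isEmpty_or_nonempty V with hV | hV
  · rw [Set.range_eq_empty, Set.ncard_empty]; exact Nat.zero_le _
  have hc' : ∀ i, ∃ v, i ∈ Set.range c → c v = i ∧ IsBChromatic c v := fun i => by
    by_cases hi : i ∈ Set.range c
    · obtain ⟨v, hv⟩ := hc i hi
      exact ⟨v, fun _ => hv⟩
    · exact ⟨hV.some, fun h => absurd h hi⟩
  choose f hf using hc'
  refine Set.ncard_le_ncard_of_injOn f (fun i hi => (hf i hi).2.ncard_range_le_deg) ?_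
  intro i hi j hj hij
  rw [← (hf i hi).1, ← (hf j hj).1, hij]

/-- In a tight graph, a b-colouring that is injective on the dense vertices uses on them all of its
colours, and makes the colours in the neighbourhood of a dense vertex pairwise distinct. -/
theorem IsBColouring.dense_of_injOn {c : G.Coloring ℕ+} (hc : IsBColouring c) (hG : IsTight G)
    (hinj : Set.InjOn c (denseSet G)) :
    (∀ v, ∃ u ∈ denseSet G, c u = c v) ∧ (∀ u ∈ denseSet G, IsBChromatic c u) ∧
      ∀ u ∈ denseSet G, Set.InjOn c (G.neighborSet u) := by
  have hcard : (c '' denseSet G).ncard = mDegree G := by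
    rw [hinj.ncard_image, hG.1]
  have himg : c '' denseSet G = Set.range c :=
    Set.eq_of_subset_of_ncard_le (Set.image_subset_range _ _)
      (hcard ▸ hc.ncard_range_le_mDegree) (Set.toFinite _)
  rw [himg] at hcard
  -- The b-chromatic vertex of the colour of u sees m - 1 colours, so it is dense, and injectivity
  -- on T identifies it with u.
  have hb : ∀ u ∈ denseSet G, IsBChromatic c u := by
    intro u hu
    obtain ⟨v, hv, hvb⟩ := hc (c u) ⟨u, rfl⟩
    have hvd : v ∈ denseSet G := hcard.symm.trans_le hvb.ncard_range_le_deg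
    rwa [← hinj hvd hu hv]
  refine ⟨fun v => ?_, hb, fun u hu => ?_⟩
  · have : c v ∈ c '' denseSet G := himg ▸ ⟨v, rfl⟩
    exact this
  -- The m - 1 neighbours of u show at least m - 1 colours, so none repeats.
  · apply Set.injOn_of_ncard_image_eq _ (Set.toFinite _)
    apply le_antisymm Set.ncard_image_le
    have h₁ := (hb u hu).ncard_range_le
    rw [Set.ncard_sdiff_singleton_of_mem (Set.mem_range_self u), hcard] at h₁
    have h₂ := hG.2 u hu
    unfold deg at h₂
    omega

theorem IsBPrecolouringExtension.criterion {S' : Set V} {c' : PreColouring G S'}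
    {c : G.Coloring ℕ+} (hc : IsBPrecolouringExtension G S' c' c) (hG : IsTight G)
    (hS : S' ⊆ outerBoundary G (denseSet G)) (hp : IsPartialBColouring G S' c') :
    (∀ s : ↥(S' ∪ denseSet G), (s : V) ∈ S' →
      ∃ u : ↥(S' ∪ denseSet G), (u : V) ∈ denseSet G ∧ c' u = c' s) ∧
    ∃ f : ↥(T₂ G S' c') → ↥(outerBoundary G (denseSet G) \ S'),
        Function.Bijective f ∧ ∀ u : ↥(T₂ G S' c'), AuxAdj G S' c' u (f u) := by
  have hext : ∀ v (hv : v ∈ S' ∪ denseSet G), c' ⟨v, hv⟩ = c v :=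
    fun v hv => (hc.extends_pre ⟨v, hv⟩).symm
  have hinj : Set.InjOn c (denseSet G) := by
    intro u hu u' hu' h
    by_contra hne
    refine hp.injective_on_dense ⟨u, Set.mem_union_right _ hu⟩ ⟨u', Set.mem_union_right _ hu'⟩
      hu hu' (fun h => hne (congrArg Subtype.val h)) ?_
    rw [hext, hext, h]
  obtain ⟨hall, hb, hnb⟩ := hc.isBColouring.dense_of_injOn hG hinj
  -- As u is not in T₁, some dense w ≠ u is not adjacent to it. The neighbour of w with the colour
  -- of u is not dense, by injectivity, and not in S', since u is not in T'.
  have hT₂ : ∀ u ∈ T₂ G S' c', ∃ s ∈ outerBoundary G (denseSet G) \ S', c s = c u := by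
    rintro u ⟨hu, hu'⟩
    simp only [Set.mem_union, not_or] at hu'
    obtain ⟨w, hw, hwu, hnadj⟩ : ∃ w ∈ denseSet G, w ≠ u ∧ ¬ G.Adj w u := by
      by_contra! h
      exact hu'.1 ⟨hu, h⟩
    obtain ⟨x, hx, hcx⟩ := hb w hw (c u) ⟨u, rfl⟩ fun h => hwu (hinj hw hu h.symm)
    have hxT : x ∉ denseSet G := fun h => hnadj (hinj h hu hcx ▸ hx)
    refine ⟨x, ⟨mem_outerBoundary hw hx hxT, fun hxS => hu'.2 ?_⟩, hcx⟩
    exact ⟨⟨u, Set.mem_union_right _ hu⟩, ⟨x, Set.mem_union_left _ hxS⟩, rfl, hu, hxS,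
      by rw [hext, hext, hcx]⟩
  -- Two boundary vertices in one class, one of them outside S', contradict the boundary condition.
  have huniq : ∀ s ∈ outerBoundary G (denseSet G) \ S', ∀ s' ∈ outerBoundary G (denseSet G),
      c s = c s' → s = s' := by
    intro s hs s' hs' h
    by_contra hne
    refine Set.disjoint_left.1 (hc.boundary_class (c s) ?_) rfl hs
    rw [← Set.ncard_pair hne]
    refine Set.ncard_le_ncard ?_
    rintro x (rfl | rfl)
    · exact ⟨rfl, hs.1⟩
    · exact ⟨h.symm, hs'⟩
  choose! f hf hcf using hT₂
  refine ⟨fun s _ => ?_, fun u => ⟨f u, hf u u.2⟩, ⟨fun u u' h => ?_, fun s => ?_⟩, fun u => ?_⟩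
  · obtain ⟨u, hu, h⟩ := hall s
    exact ⟨⟨u, Set.mem_union_right _ hu⟩, hu, by rw [hext, h, ← hc.extends_pre]⟩
  · have h' : f u = f u' := congrArg Subtype.val h
    exact Subtype.ext (hinj u.2.1 u'.2.1 (by rw [← hcf u u.2, ← hcf u' u'.2, h']))
  · obtain ⟨u, hu, hcu⟩ := hall s
    have huT : u ∈ T₂ G S' c' := by
      refine ⟨hu, ?_⟩
      rintro (h | ⟨x, y, rfl, -, hy, hxy⟩)
      -- If u were in T₁, a dense neighbour w of s would also be adjacent to u and see the common
      -- colour twice.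
      · obtain ⟨w, hw, hws⟩ := exists_adj_of_mem_outerBoundary s.2.1
        have hwu : w ≠ u := fun h => c.valid hws (by rw [h, hcu])
        have : u = s := hnb w hw (h.2 w hw hwu) hws hcu
        exact s.2.1.2 (this ▸ hu)
      · have : (s : V) = y := huniq s s.2 y (hS hy) (by
          rw [← hcu, hc.extends_pre, hc.extends_pre, hxy])
        exact s.2.2 (this ▸ hy)
    exact ⟨⟨u, huT⟩, Subtype.ext (huniq s s.2 _ (hf u huT).1 (by rw [hcf u huT, hcu])).symm⟩
  · have hne : (u : V) ≠ f u := fun h => (hf u u.2).1.2 (h ▸ u.2.1)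
    refine ⟨fun h => c.valid h (hcf u u.2).symm, ?_⟩
    rintro w ⟨hw, -⟩ ⟨h₁, h₂⟩
    have hwT : w ∈ denseSet G := by
      rcases hw with h | ⟨x, y, h, hx, -⟩
      · exact h.1
      · exact hx
    exact hne (hnb w hwT h₁.symm h₂.symm (hcf u u.2).symm)

end Necessity

/-! ### From a matching to an extension -/

section Sufficiency

variable [Finite V] {G : SimpleGraph V}

/-- The m - 1 other dense vertices exhaust the degree of w. Hence w has no neighbour in δT and is
never a common neighbour of a dense and a boundary vertex, which is why G* disregards T₁. -/
theorem neighborSet_eq_of_mem_T₁ (hG : IsTight G) {w : V} (hw : w ∈ T₁ G) :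
    G.neighborSet w = denseSet G \ {w} := by
  refine (Set.eq_of_subset_of_ncard_le ?_ ?_ (Set.toFinite _)).symm
  · rintro x ⟨hx, hxw⟩
    exact (hw.2 x hx hxw).symm
  · have h := hG.2 w hw.1
    rw [Set.ncard_sdiff_singleton_of_mem hw.1, hG.1]
    unfold deg at h
    omega

/-- A colouring of the dense vertices and their boundary that has a dense representative for each
colour and repeats no colour in the neighbourhood of a dense vertex extends to a b-colouring. -/
theorem exists_isBColouring_of_injOn (hG : IsTight G) (c₀ : V → ℕ+)
    (hinj : Set.InjOn c₀ (denseSet G))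
    (hrep : ∀ x ∈ denseSet G ∪ outerBoundary G (denseSet G), ∃ u ∈ denseSet G, c₀ u = c₀ x)
    (hprop : ∀ v ∈ denseSet G ∪ outerBoundary G (denseSet G),
      ∀ w ∈ denseSet G ∪ outerBoundary G (denseSet G), G.Adj v w → c₀ v ≠ c₀ w)
    (hnb : ∀ w ∈ denseSet G, Set.InjOn c₀ (G.neighborSet w)) :
    ∃ c : G.Coloring ℕ+, IsBColouring c ∧
      ∀ v ∈ denseSet G ∪ outerBoundary G (denseSet G), c v = c₀ v := by
  have hC : (c₀ '' denseSet G).ncard = mDegree G := by rw [hinj.ncard_image, hG.1]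
  obtain ⟨c, hcC, hc⟩ := exists_greedy_extension (c₀ '' denseSet G) _ c₀ hrep hprop (by
    intro v hv
    have : ¬ mDegree G ≤ deg G v + 1 := fun h => hv (Or.inl h)
    omega)
  have hN : ∀ w ∈ denseSet G, ∀ x, G.Adj w x →
      x ∈ denseSet G ∪ outerBoundary G (denseSet G) := by
    intro w hw x hx
    by_cases h : x ∈ denseSet G
    · exact Or.inl h
    · exact Or.inr (mem_outerBoundary hw hx h)
  refine ⟨c, ?_, hc⟩
  rintro i ⟨v, rfl⟩
  obtain ⟨w, hw, hwv⟩ := hcC v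
  have hwW := hc w (Or.inl hw)
  refine ⟨w, by rw [hwW, hwv], ?_⟩
  rintro j ⟨v', rfl⟩ hj
  -- The m - 1 neighbours of w carry distinct colours among the m - 1 colours other than its own, so
  -- all of these occur.
  have himg : c₀ '' G.neighborSet w = (c₀ '' denseSet G) \ {c₀ w} := by
    refine Set.eq_of_subset_of_ncard_le ?_ ?_ (Set.toFinite _)
    · rintro _ ⟨x, hx, rfl⟩
      exact ⟨hrep x (hN w hw x hx), fun h => hprop w (Or.inl hw) x (hN w hw x hx) hx h.symm⟩
    · have h := hG.2 w hw
      rw [(hnb w hw).ncard_image, Set.ncard_sdiff_singleton_of_mem (Set.mem_image_of_mem _ hw), hC]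
      unfold deg at h
      omega
  have : c v' ∈ c₀ '' G.neighborSet w := by
    rw [himg]
    exact ⟨hcC v', hwW ▸ hj⟩
  obtain ⟨x, hx, h⟩ := this
  exact ⟨x, hx, by rw [hc x (hN w hw x hx), h]⟩

theorem hasBPrecolouringExtension_of_bijective {S' : Set V} {c' : PreColouring G S'}
    (hG : IsTight G) (hS : S' ⊆ outerBoundary G (denseSet G)) (hp : IsPartialBColouring G S' c')
    (hcol : ∀ s : ↥(S' ∪ denseSet G), (s : V) ∈ S' →
      ∃ u : ↥(S' ∪ denseSet G), (u : V) ∈ denseSet G ∧ c' u = c' s)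
    (f : ↥(T₂ G S' c') → ↥(outerBoundary G (denseSet G) \ S')) (hf : Function.Bijective f)
    (hadj : ∀ u : ↥(T₂ G S' c'), AuxAdj G S' c' u (f u)) :
    HasBPrecolouringExtension G S' c' := by
  classical
  let g := (Equiv.ofBijective f hf).symm
  have hfg : ∀ s, f (g s) = s := (Equiv.ofBijective f hf).apply_symm_apply
  -- A vertex of δT \ S' takes the colour of its partner. The value 1 elsewhere is arbitrary,
  -- because `exists_isBColouring_of_injOn` constrains only T ∪ δT and the neighbourhoods of T.
  let c₀ : V → ℕ+ := fun v =>
    if h : v ∈ S' ∪ denseSet G then c' ⟨v, h⟩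
    else if h : v ∈ outerBoundary G (denseSet G) \ S' then
      c' ⟨g ⟨v, h⟩, Set.mem_union_right _ (g ⟨v, h⟩).2.1⟩ else 1
  have hc₀ : ∀ v (h : v ∈ S' ∪ denseSet G), c₀ v = c' ⟨v, h⟩ := fun v h => by
    simp only [c₀, dif_pos h]
  have hc₀f : ∀ x (h : x ∈ outerBoundary G (denseSet G) \ S'),
      ∃ u : ↥(T₂ G S' c'), x = f u ∧ c₀ x = c₀ u := fun x h => by
    have hx : x ∉ S' ∪ denseSet G := by
      rintro (h' | h')
      · exact h.2 h'
      · exact h.1.2 h'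
    refine ⟨g ⟨x, h⟩, by rw [hfg], ?_⟩
    rw [hc₀ _ (Set.mem_union_right _ (g ⟨x, h⟩).2.1)]
    simp only [c₀, dif_neg hx, dif_pos h]
  have hinj : Set.InjOn c₀ (denseSet G) := by
    intro u hu u' hu' h
    by_contra hne
    refine hp.injective_on_dense ⟨u, Set.mem_union_right _ hu⟩ ⟨u', Set.mem_union_right _ hu'⟩
      hu hu' (fun h => hne (congrArg Subtype.val h)) ?_
    rw [← hc₀, ← hc₀, h]
  have hT' : ∀ u ∈ denseSet G, ∀ s ∈ S', c₀ u = c₀ s → u ∈ T' G S' c' := by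
    intro u hu s hs h
    refine ⟨⟨u, Set.mem_union_right _ hu⟩, ⟨s, Set.mem_union_left _ hs⟩, rfl, hu, hs, ?_⟩
    rw [← hc₀, ← hc₀, h]
  have hrep : ∀ x ∈ denseSet G ∪ outerBoundary G (denseSet G),
      ∃ u ∈ denseSet G, c₀ u = c₀ x := by
    rintro x (hx | hx)
    · exact ⟨x, hx, rfl⟩
    · by_cases hxS : x ∈ S'
      · obtain ⟨u, hu, h⟩ := hcol ⟨x, Set.mem_union_left _ hxS⟩ hxS
        exact ⟨u, hu, by rw [hc₀ u u.2, hc₀ x (Set.mem_union_left _ hxS), ← h]⟩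
      · obtain ⟨u, -, h⟩ := hc₀f x ⟨hx, hxS⟩
        exact ⟨u, u.2.1, h.symm⟩
  -- Within T ∪ δT the colour class of u is just the matched pair; a vertex of S' in it would put u
  -- into T'.
  have hclass : ∀ u : ↥(T₂ G S' c'), ∀ x ∈ denseSet G ∪ outerBoundary G (denseSet G),
      c₀ x = c₀ u → x = u ∨ x = f u := by
    rintro u x (hx | hx) h
    · exact Or.inl (hinj hx u.2.1 h)
    · by_cases hxS : x ∈ S'
      · exact absurd (Or.inr (hT' u u.2.1 x hxS h.symm)) u.2.2
      · obtain ⟨u', rfl, h'⟩ := hc₀f x ⟨hx, hxS⟩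
        have : u' = u := Subtype.ext (hinj u'.2.1 u.2.1 (by rw [← h', h]))
        exact Or.inr (by rw [this])
  have hpropB : ∀ v ∈ outerBoundary G (denseSet G) \ S',
      ∀ w ∈ denseSet G ∪ outerBoundary G (denseSet G), G.Adj v w → c₀ v ≠ c₀ w := by
    intro v hv w hw hvw h
    obtain ⟨u, rfl, hu⟩ := hc₀f v hv
    rcases hclass u w hw (by rw [← h, hu]) with rfl | rfl
    · exact (hadj u).1 hvw.symm
    · exact G.loopless.irrefl _ hvw
  have hcases : ∀ v ∈ denseSet G ∪ outerBoundary G (denseSet G),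
      v ∈ S' ∪ denseSet G ∨ v ∈ outerBoundary G (denseSet G) \ S' := by
    rintro v (hv | hv)
    · exact Or.inl (Or.inr hv)
    · by_cases h : v ∈ S'
      · exact Or.inl (Or.inl h)
      · exact Or.inr ⟨hv, h⟩
  have hprop : ∀ v ∈ denseSet G ∪ outerBoundary G (denseSet G),
      ∀ w ∈ denseSet G ∪ outerBoundary G (denseSet G), G.Adj v w → c₀ v ≠ c₀ w := by
    intro v hv w hw hvw
    rcases hcases v hv with hv' | hv'
    · rcases hcases w hw with hw' | hw'
      · rw [hc₀ v hv', hc₀ w hw']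
        exact c'.valid hvw
      · exact (hpropB w hw' v hv hvw.symm).symm
    · exact hpropB v hv' w hw hvw
  have hN : ∀ w ∈ denseSet G, ∀ x, G.Adj w x →
      x ∈ denseSet G ∪ outerBoundary G (denseSet G) := by
    intro w hw x hx
    by_cases h : x ∈ denseSet G
    · exact Or.inl h
    · exact Or.inr (mem_outerBoundary hw hx h)
  have hnotT₂ : ∀ u ∈ denseSet G, u ∉ T₂ G S' c' →
      ∀ x ∈ outerBoundary G (denseSet G) \ S', c₀ x ≠ c₀ u := by
    intro u hu huT x hx h
    obtain ⟨u', -, h'⟩ := hc₀f x hx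
    exact huT (hinj u'.2.1 hu (by rw [← h', h]) ▸ u'.2)
  -- Let u be the dense vertex with the repeated colour. If u is in T₂, an edge of G* (or w in T₁)
  -- rules out a common neighbour w of u and its partner. If u is in T', `unique_neighbour` applies.
  -- Otherwise u is the only vertex of T ∪ δT with its colour.
  have hnb : ∀ w ∈ denseSet G, Set.InjOn c₀ (G.neighborSet w) := by
    intro w hw x hx y hy hxy
    have hxW := hN w hw x hx
    have hyW := hN w hw y hy
    obtain ⟨u, hu, hux⟩ := hrep x hxW
    have huw : w ≠ u := by
      rintro rfl
      exact hprop w (Or.inl hw) x hxW hx hux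
    by_cases huT₂ : u ∈ T₂ G S' c'
    · have hboth : ¬ (G.Adj w u ∧ G.Adj w (f ⟨u, huT₂⟩)) := by
        rintro ⟨h₁, h₂⟩
        by_cases hwT : w ∈ T₂ G S' c' ∪ T' G S' c'
        · exact (hadj ⟨u, huT₂⟩).2 w ⟨hwT, huw⟩ ⟨h₁.symm, h₂.symm⟩
        · have hwT₁ : w ∈ T₁ G := by
            by_contra h
            exact hwT (Or.inl ⟨hw, fun h' => h'.elim h fun h' => hwT (Or.inr h')⟩)
          have : (f ⟨u, huT₂⟩ : V) ∈ G.neighborSet w := h₂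
          rw [neighborSet_eq_of_mem_T₁ hG hwT₁] at this
          exact (f ⟨u, huT₂⟩).2.1.2 this.1
      rcases hclass ⟨u, huT₂⟩ x hxW hux.symm with h₁ | h₁ <;>
        rcases hclass ⟨u, huT₂⟩ y hyW (hxy.symm.trans hux.symm) with h₂ | h₂
      · rw [h₁, h₂]
      · subst h₁ h₂
        exact absurd ⟨hx, hy⟩ hboth
      · subst h₁ h₂
        exact absurd ⟨hy, hx⟩ hboth
      · rw [h₁, h₂]
    · have hpre : ∀ z, G.Adj w z → c₀ z = c₀ u → z ∈ S' ∪ denseSet G := by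
        intro z hz hzu
        exact (hcases z (hN w hw z hz)).resolve_right fun h => hnotT₂ u hu huT₂ z h hzu
      have hx' := hpre x hx hux.symm
      have hy' := hpre y hy (hxy.symm.trans hux.symm)
      by_cases huT' : u ∈ T' G S' c'
      · obtain ⟨u₀, s, rfl, -, hs, hus⟩ := huT'
        have h := hp.unique_neighbour u₀ hu ⟨s, hs, hus⟩ w hw huw
        rw [hc₀ u₀ u₀.2, hc₀ x hx'] at hux
        rw [hc₀ x hx', hc₀ y hy'] at hxy
        exact congrArg Subtype.val (h.unique (y₁ := ⟨x, hx'⟩) (y₂ := ⟨y, hy'⟩)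
          ⟨hx, hux.symm⟩ ⟨hy, hxy.symm.trans hux.symm⟩)
      · have hT : ∀ z ∈ S' ∪ denseSet G, c₀ z = c₀ u → z = u := by
          rintro z (hz | hz) h
          · exact absurd (hT' u hu z hz h.symm) huT'
          · exact hinj hz hu h
        rw [hT x hx' hux.symm, hT y hy' (hxy.symm.trans hux.symm)]
  obtain ⟨c, hcb, hc⟩ := exists_isBColouring_of_injOn hG c₀ hinj hrep hprop hnb
  refine ⟨c, hcb, fun v => ?_, fun i hi => ?_⟩
  · have hv : (v : V) ∈ denseSet G ∪ outerBoundary G (denseSet G) :=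
      v.2.elim (fun h => Or.inr (hS h)) Or.inl
    rw [hc v hv, hc₀ v v.2]
  · rw [Set.disjoint_left]
    rintro x hxi hx
    obtain ⟨u, rfl, hu⟩ := hc₀f x hx
    -- A class containing a vertex of δT \ S' meets δT in that vertex alone.
    have hsub : c.colorClass i ∩ outerBoundary G (denseSet G) ⊆ {(f u : V)} := by
      rintro y ⟨hyi, hy⟩
      have hcy : c y = c (f u) := Eq.trans hyi (Eq.symm hxi)
      rw [hc y (Or.inr hy), hc _ (Or.inr hx.1), hu] at hcy
      rcases hclass u y (Or.inr hy) hcy with h | h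
      · exact absurd (h ▸ u.2.1) hy.2
      · exact h
    have := Set.ncard_le_ncard hsub
    rw [Set.ncard_singleton] at this
    omega

end Sufficiency

theorem hasBPrecolouringExtension_iff_bijective [Finite V] {G : SimpleGraph V} {S' : Set V}
    {c' : PreColouring G S'} (hG : IsTight G) (hS : S' ⊆ outerBoundary G (denseSet G))
    (hp : IsPartialBColouring G S' c') :
    HasBPrecolouringExtension G S' c' ↔
      (∀ s : ↥(S' ∪ denseSet G), (s : V) ∈ S' →
        ∃ u : ↥(S' ∪ denseSet G), (u : V) ∈ denseSet G ∧ c' u = c' s) ∧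
      ∃ f : ↥(T₂ G S' c') → ↥(outerBoundary G (denseSet G) \ S'),
        Function.Bijective f ∧ ∀ u : ↥(T₂ G S' c'), AuxAdj G S' c' u (f u) :=
  ⟨fun ⟨_, hc⟩ => hc.criterion hG hS hp,
    fun ⟨hcol, f, hf, hadj⟩ => hasBPrecolouringExtension_of_bijective hG hS hp hcol f hf hadj⟩

end BCol

/-! ### A language of bounded loops

Expressions with bounded sums and statements with bounded repetition, where every loop runs `n`
times for a fixed parameter `n`. They compile to random access machine programs whose running time
is a polynomial in `n`. -/

namespace RAM

/-- Expressions over variables, arrays and the loop bound. -/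
inductive Exp : Type
  | const (c : ℕ) : Exp
  | var (x : ℕ) : Exp
  | bound : Exp
  | add (e f : Exp) : Exp
  | sub (e f : Exp) : Exp
  | arr (a : ℕ) (e : Exp) : Exp
  /-- the sum of the values of `e` as the variable `x` runs through the numbers below the bound -/
  | sum (x : ℕ) (e : Exp) : Exp

namespace Exp

/-- The value of an expression. -/
def eval (n : ℕ) (A : ℕ → ℕ → ℕ) : Exp → (ℕ → ℕ) → ℕ
  | const c, _ => c
  | var x, v => v x
  | bound, _ => n
  | add e f, v => eval n A e v + eval n A f v
  | sub e f, v => eval n A e v - eval n A f v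
  | arr a e, v => A a (eval n A e v)
  | sum x e, v => ∑ i ∈ Finset.range n, eval n A e (Function.update v x i)

/-- Compilation of an expression. The bound is in register `0`, the variable `x` in
register `2 * x + 1`, and the registers `2 * j + 2` with `k ≤ j` serve as scratch space, the first
of which receives the value. -/
def compile : Exp → ℕ → Prog
  | const c, k => .const (2 * k + 2) c
  | var x, k => .copy (2 * k + 2) (2 * x + 1)
  | bound, k => .copy (2 * k + 2) 0
  | add e f, k => .seq (compile e k) (.seq (compile f (k + 1))
      (.add (2 * k + 2) (2 * k + 2) (2 * (k + 1) + 2)))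
  | sub e f, k => .seq (compile e k) (.seq (compile f (k + 1))
      (.sub (2 * k + 2) (2 * k + 2) (2 * (k + 1) + 2)))
  | arr a e, k => .seq (compile e k) (.load (2 * k + 2) a (2 * k + 2))
  -- Scratch cell `k` saves the old content of `x`, `k + 1` accumulates, `k + 2` counts down, and `k
  -- + 3` serves the summand and then holds the constant 1.
  | sum x e, k =>
      .seq (.copy (2 * k + 2) (2 * x + 1)) <|
      .seq (.const (2 * x + 1) 0) <|
      .seq (.const (2 * (k + 1) + 2) 0) <|
      .seq (.copy (2 * (k + 2) + 2) 0) <|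
      .seq (.loop (2 * (k + 2) + 2) <|
        .seq (compile e (k + 3)) <|
        .seq (.add (2 * (k + 1) + 2) (2 * (k + 1) + 2) (2 * (k + 3) + 2)) <|
        .seq (.const (2 * (k + 3) + 2) 1) <|
        .seq (.add (2 * x + 1) (2 * x + 1) (2 * (k + 3) + 2)) <|
        .sub (2 * (k + 2) + 2) (2 * (k + 2) + 2) (2 * (k + 3) + 2)) <|
      .seq (.copy (2 * x + 1) (2 * k + 2)) <|
      .copy (2 * k + 2) (2 * (k + 1) + 2)

/-- The running time of a compiled expression as a polynomial in the bound. -/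
noncomputable def cost : Exp → Polynomial ℕ
  | const _ => 1
  | var _ => 1
  | bound => 1
  | add e f => cost e + (cost f + 1)
  | sub e f => cost e + (cost f + 1)
  | arr _ e => cost e + 1
  -- Each pass costs four instructions and a test besides the summand; the 7 counts six instructions
  -- around the loop and its final test.
  | sum _ e => Polynomial.X * (cost e + 5) + 7

end Exp

/-- The values of the variables in a state. -/
def State.vars (s : State) (x : ℕ) : ℕ := s.reg (2 * x + 1)

theorem State.setReg_reg (s : State) (x n y : ℕ) :
    (s.setReg x n).reg y = if y = x then n else s.reg y := by
  simp [State.setReg, Function.update_apply]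

theorem State.setArr_arr (s : State) (a i n : ℕ) : (s.setArr a i n).arr =
    Function.update s.arr a (Function.update (s.arr a) i n) := rfl

@[simp]
theorem State.setArr_reg (s : State) (a i n : ℕ) : (s.setArr a i n).reg = s.reg := rfl

theorem Exec.cast {p : Prog} {s s' : State} {t t' : ℕ} (h : Exec p s t s') (ht : t = t') :
    Exec p s t' s' := ht ▸ h

/-- What it means that the compiled expression runs correctly from all states. -/
def Exp.Correct (e : Exp) : Prop :=
  ∀ (k : ℕ) (s : State), ∃ s' : State,
    Exec (e.compile k) s (e.cost.eval (s.reg 0)) s' ∧ s'.arr = s.arr ∧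
    s'.reg (2 * k + 2) = e.eval (s.reg 0) s.arr s.vars ∧
    ∀ r, r % 2 = 1 ∨ r < 2 * k + 2 → s'.reg r = s.reg r

theorem State.vars_congr {s s' : State} (h : ∀ r, r % 2 = 1 → s'.reg r = s.reg r) :
    s'.vars = s.vars :=
  funext fun x => h (2 * x + 1) (by omega)

/-- For the induction, the number m of remaining passes is separated from the bound in register `0`,
and the start value of `x` is arbitrary. -/
theorem Exp.Correct.sum_loop {e : Exp} (he : e.Correct) (x k m : ℕ) :
    ∀ s : State, s.reg (2 * (k + 2) + 2) = m → ∃ s' : State,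
      Exec (.loop (2 * (k + 2) + 2) <|
        .seq (e.compile (k + 3)) <|
        .seq (.add (2 * (k + 1) + 2) (2 * (k + 1) + 2) (2 * (k + 3) + 2)) <|
        .seq (.const (2 * (k + 3) + 2) 1) <|
        .seq (.add (2 * x + 1) (2 * x + 1) (2 * (k + 3) + 2)) <|
        .sub (2 * (k + 2) + 2) (2 * (k + 2) + 2) (2 * (k + 3) + 2)) s
        (m * (e.cost.eval (s.reg 0) + 5) + 1) s' ∧
      s'.arr = s.arr ∧
      s'.reg (2 * (k + 1) + 2) = s.reg (2 * (k + 1) + 2) + ∑ i ∈ Finset.range m,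
        e.eval (s.reg 0) s.arr (Function.update s.vars x (s.reg (2 * x + 1) + i)) ∧
      ∀ r, r ≠ 2 * x + 1 → r % 2 = 1 ∨ r < 2 * (k + 1) + 2 → s'.reg r = s.reg r := by
  induction m with
  | zero =>
    intro s hs
    refine ⟨s, (Exec.loop_zero hs).cast (by simp), rfl, by simp, fun r _ _ => rfl⟩
  | succ m ih =>
    intro s hs
    obtain ⟨s₁, h₁, harr, hval, hkeep⟩ := he (k + 3) s
    let s₂ := s₁.setReg (2 * (k + 1) + 2)
      (s₁.reg (2 * (k + 1) + 2) + s₁.reg (2 * (k + 3) + 2))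
    let s₃ := s₂.setReg (2 * (k + 3) + 2) 1
    let s₄ := s₃.setReg (2 * x + 1) (s₃.reg (2 * x + 1) + s₃.reg (2 * (k + 3) + 2))
    let s₅ := s₄.setReg (2 * (k + 2) + 2) (s₄.reg (2 * (k + 2) + 2) - s₄.reg (2 * (k + 3) + 2))
    have hreg : ∀ r, r % 2 = 1 ∨ r < 2 * (k + 1) + 2 →
        s₅.reg r = if r = 2 * x + 1 then s.reg r + 1 else s.reg r := by
      intro r hr
      have h1 : r ≠ 2 * (k + 1) + 2 := by omega
      have h2 : r ≠ 2 * (k + 2) + 2 := by omega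
      have h3 : r ≠ 2 * (k + 3) + 2 := by omega
      have h4 : (2 * x + 1) ≠ 2 * (k + 3) + 2 := by omega
      have h5 : (2 * x + 1) ≠ 2 * (k + 1) + 2 := by omega
      simp only [s₅, s₄, s₃, s₂, State.setReg_reg, h1, h2, h3, h4, h5, if_true, if_false]
      rw [hkeep r (by omega), hkeep (2 * x + 1) (by omega)]
      split_ifs with h
      · rw [h]
      · rfl
    have hcnt : s₅.reg (2 * (k + 2) + 2) = m := by
      have h1 : 2 * (k + 2) + 2 ≠ 2 * x + 1 := by omega
      have h2 : 2 * (k + 3) + 2 ≠ 2 * x + 1 := by omega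
      simp [s₅, s₄, s₃, s₂, State.setReg_reg, h1, h2]
      rw [hkeep _ (by omega), hs]
      rfl
    have hacc : s₅.reg (2 * (k + 1) + 2) =
        s.reg (2 * (k + 1) + 2) + e.eval (s.reg 0) s.arr s.vars := by
      have h1 : 2 * (k + 1) + 2 ≠ 2 * x + 1 := by omega
      simp [s₅, s₄, s₃, s₂, State.setReg_reg, h1]
      rw [hkeep _ (by omega), hval]
    have harr₅ : s₅.arr = s.arr := harr
    have hvars : s₅.vars = Function.update s.vars x (s.reg (2 * x + 1) + 1) := by
      funext y
      rw [State.vars, hreg _ (by omega), Function.update_apply]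
      by_cases hy : y = x
      · simp [hy]
      · rw [if_neg (by omega), if_neg hy, State.vars]
    have h0 : s₅.reg 0 = s.reg 0 := by rw [hreg 0 (by omega), if_neg (by omega)]
    obtain ⟨s₆, h₆, harr₆, hval₆, hkeep₆⟩ := ih s₅ hcnt
    refine ⟨s₆, (Exec.loop_pos (by omega)
      (h₁.seq ((Exec.add _ _ _ _).seq ((Exec.const _ _ _).seq ((Exec.add _ _ _ _).seq
        (Exec.sub _ _ _ _))))) h₆).cast ?_, harr₆.trans harr₅, ?_, ?_⟩
    · rw [h0]; ring
    · rw [hval₆, hacc, Finset.sum_range_succ', h0, harr₅, hvars, hreg _ (by omega), if_pos rfl]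
      have hid : Function.update s.vars x (s.reg (2 * x + 1) + 0) = s.vars := by
        exact Function.update_eq_self x s.vars
      rw [hid]
      simp only [Function.update_idem]
      rw [add_assoc, add_comm (e.eval _ _ _)]
      congr 2
      refine Finset.sum_congr rfl fun i _ => ?_
      rw [show s.reg (2 * x + 1) + 1 + i = s.reg (2 * x + 1) + (i + 1) by ring]
    · intro r hr hr'
      rw [hkeep₆ r hr hr', hreg r hr', if_neg hr]

theorem Exp.correct (e : Exp) : e.Correct := by
  induction e with
  | const c =>
    intro k s
    refine ⟨_, (Exec.const _ _ _).cast (by simp [cost]), rfl, by simp [State.setReg_reg, eval], ?_⟩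
    intro r hr
    rw [State.setReg_reg, if_neg (by omega)]
  | var x =>
    intro k s
    refine ⟨_, (Exec.copy _ _ _).cast (by simp [cost]), rfl,
      by simp [State.setReg_reg, eval, State.vars], ?_⟩
    intro r hr
    rw [State.setReg_reg, if_neg (by omega)]
  | bound =>
    intro k s
    refine ⟨_, (Exec.copy _ _ _).cast (by simp [cost]), rfl, by simp [State.setReg_reg, eval], ?_⟩
    intro r hr
    rw [State.setReg_reg, if_neg (by omega)]
  | add e f he hf =>
    intro k s
    obtain ⟨s₁, h₁, harr₁, hval₁, hkeep₁⟩ := he k s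
    obtain ⟨s₂, h₂, harr₂, hval₂, hkeep₂⟩ := hf (k + 1) s₁
    have h0 : s₁.reg 0 = s.reg 0 := hkeep₁ 0 (by omega)
    refine ⟨_, (h₁.seq (h₂.seq (Exec.add _ _ _ _))).cast ?_, harr₂.trans harr₁, ?_, ?_⟩
    · simp [cost, h0]
    · rw [State.setReg_reg, if_pos rfl, hval₂, hkeep₂ _ (by omega), hval₁, h0, harr₁,
        State.vars_congr fun r hr => hkeep₁ r (Or.inl hr), eval]
    · intro r hr
      rw [State.setReg_reg, if_neg (by omega), hkeep₂ r (by omega), hkeep₁ r hr]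
  | sub e f he hf =>
    intro k s
    obtain ⟨s₁, h₁, harr₁, hval₁, hkeep₁⟩ := he k s
    obtain ⟨s₂, h₂, harr₂, hval₂, hkeep₂⟩ := hf (k + 1) s₁
    have h0 : s₁.reg 0 = s.reg 0 := hkeep₁ 0 (by omega)
    refine ⟨_, (h₁.seq (h₂.seq (Exec.sub _ _ _ _))).cast ?_, harr₂.trans harr₁, ?_, ?_⟩
    · simp [cost, h0]
    · rw [State.setReg_reg, if_pos rfl, hval₂, hkeep₂ _ (by omega), hval₁, h0, harr₁,
        State.vars_congr fun r hr => hkeep₁ r (Or.inl hr), eval]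
    · intro r hr
      rw [State.setReg_reg, if_neg (by omega), hkeep₂ r (by omega), hkeep₁ r hr]
  | arr a e he =>
    intro k s
    obtain ⟨s₁, h₁, harr₁, hval₁, hkeep₁⟩ := he k s
    refine ⟨_, (h₁.seq (Exec.load _ _ _ _)).cast ?_, harr₁, ?_, ?_⟩
    · simp [cost]
    · rw [State.setReg_reg, if_pos rfl, hval₁, harr₁, eval]
    · intro r hr
      rw [State.setReg_reg, if_neg (by omega), hkeep₁ r hr]
  | sum x e he =>
    intro k s
    let s₁ := s.setReg (2 * k + 2) (s.reg (2 * x + 1))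
    let s₂ := s₁.setReg (2 * x + 1) 0
    let s₃ := s₂.setReg (2 * (k + 1) + 2) 0
    let s₄ := s₃.setReg (2 * (k + 2) + 2) (s₃.reg 0)
    have hreg : ∀ r, r % 2 = 1 ∨ r < 2 * k + 2 →
        s₄.reg r = if r = 2 * x + 1 then 0 else s.reg r := by
      intro r hr
      have h1 : r ≠ 2 * (k + 1) + 2 := by omega
      have h2 : r ≠ 2 * (k + 2) + 2 := by omega
      have h3 : r ≠ 2 * k + 2 := by omega
      simp only [s₄, s₃, s₂, s₁, State.setReg_reg, h1, h2, h3, if_false]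
    have h0 : s₄.reg 0 = s.reg 0 := by rw [hreg 0 (by omega), if_neg (by omega)]
    have hcnt : s₄.reg (2 * (k + 2) + 2) = s.reg 0 := by
      simp [s₄, s₃, s₂, s₁, State.setReg_reg]
    have hacc : s₄.reg (2 * (k + 1) + 2) = 0 := by
      simp [s₄, s₃, State.setReg_reg]
    have hsave : s₄.reg (2 * k + 2) = s.reg (2 * x + 1) := by
      have h1 : 2 * k + 2 ≠ 2 * x + 1 := by omega
      simp [s₄, s₃, s₂, s₁, State.setReg_reg, h1]
    have hvars : s₄.vars = Function.update s.vars x 0 := by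
      funext y
      rw [State.vars, hreg _ (by omega), Function.update_apply]
      by_cases hy : y = x
      · simp [hy]
      · rw [if_neg (by omega), if_neg hy, State.vars]
    obtain ⟨s₅, h₅, harr₅, hval₅, hkeep₅⟩ := he.sum_loop x k _ s₄ hcnt
    refine ⟨_, ((Exec.copy _ _ _).seq <| (Exec.const _ _ _).seq <| (Exec.const _ _ _).seq <|
      (Exec.copy _ _ _).seq <| h₅.seq <| (Exec.copy _ _ _).seq <| Exec.copy _ _ _).cast ?_,
      harr₅, ?_, ?_⟩
    · rw [h0]; simp [cost]; ring
    · rw [State.setReg_reg, if_pos rfl, State.setReg_reg, if_neg (by omega), hval₅, hacc, h0,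
        hvars, hreg _ (by omega), if_pos rfl, eval]
      simp only [Function.update_idem, zero_add]
      rfl
    · intro r hr
      rw [State.setReg_reg, if_neg (by omega), State.setReg_reg]
      by_cases hrx : r = 2 * x + 1
      · rw [if_pos hrx, hkeep₅ _ (by omega) (by omega), hsave, hrx]
      · rw [if_neg hrx, hkeep₅ r hrx (by omega), hreg r hr, if_neg hrx]

/-- Statements. -/
inductive Stmt : Type
  /-- `x := e` -/
  | assign (x : ℕ) (e : Exp) : Stmt
  /-- `a[e] := f` -/
  | store (a : ℕ) (e f : Exp) : Stmt
  | seq (p q : Stmt) : Stmt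
  /-- repeat as many times as the loop bound says -/
  | rep (p : Stmt) : Stmt

namespace Stmt

/-- The effect of a statement on the variables and the arrays. -/
def run (n : ℕ) : Stmt → (ℕ → ℕ) × (ℕ → ℕ → ℕ) → (ℕ → ℕ) × (ℕ → ℕ → ℕ)
  | assign x e, σ => (Function.update σ.1 x (e.eval n σ.2 σ.1), σ.2)
  | store a e f, σ => (σ.1, Function.update σ.2 a
      (Function.update (σ.2 a) (e.eval n σ.2 σ.1) (f.eval n σ.2 σ.1)))
  | seq p q, σ => run n q (run n p σ)
  | rep p, σ => (run n p)^[n] σ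

/-- Compilation of a statement, with scratch registers `2 * j + 2` for `k ≤ j`. -/
def compile : Stmt → ℕ → Prog
  | assign x e, k => .seq (e.compile k) (.copy (2 * x + 1) (2 * k + 2))
  | store a e f, k => .seq (e.compile k) (.seq (f.compile (k + 1))
      (.store a (2 * k + 2) (2 * (k + 1) + 2)))
  | seq p q, k => .seq (compile p k) (compile q k)
  | rep p, k => .seq (.copy (2 * k + 2) 0) (.loop (2 * k + 2) (.seq (compile p (k + 1))
      (.seq (.const (2 * (k + 1) + 2) 1) (.sub (2 * k + 2) (2 * k + 2) (2 * (k + 1) + 2)))))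

/-- The running time of a compiled statement as a polynomial in the bound. -/
noncomputable def cost : Stmt → Polynomial ℕ
  | assign _ e => e.cost + 1
  | store _ e f => e.cost + (f.cost + 1)
  | seq p q => cost p + cost q
  | rep p => Polynomial.X * (cost p + 3) + 2

/-- The last clause protects the bound in register `0` and the counters of enclosing loops; odd
registers hold the variables and may change. -/
theorem compile_correct (p : Stmt) : ∀ (k : ℕ) (s : State), ∃ s' : State,
    Exec (p.compile k) s (p.cost.eval (s.reg 0)) s' ∧
    (s'.vars, s'.arr) = p.run (s.reg 0) (s.vars, s.arr) ∧
    ∀ r, r % 2 = 0 → r < 2 * k + 2 → s'.reg r = s.reg r := by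
  induction p with
  | assign x e =>
    intro k s
    obtain ⟨s₁, h₁, harr₁, hval₁, hkeep₁⟩ := e.correct k s
    refine ⟨_, (h₁.seq (Exec.copy _ _ _)).cast (by simp [cost]), ?_, ?_⟩
    · refine Prod.ext (funext fun y => ?_) harr₁
      simp only [run, Function.update_apply]
      rw [State.vars, State.setReg_reg, hval₁]
      by_cases hy : y = x
      · simp [hy]
      · rw [if_neg (by omega), if_neg hy, hkeep₁ _ (by omega), State.vars]
    · intro r hr hr'
      rw [State.setReg_reg, if_neg (by omega), hkeep₁ r (by omega)]
  | store a e f =>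
    intro k s
    obtain ⟨s₁, h₁, harr₁, hval₁, hkeep₁⟩ := e.correct k s
    obtain ⟨s₂, h₂, harr₂, hval₂, hkeep₂⟩ := f.correct (k + 1) s₁
    have h0 : s₁.reg 0 = s.reg 0 := hkeep₁ 0 (by omega)
    have hv₁ : s₁.vars = s.vars := State.vars_congr fun r hr => hkeep₁ r (Or.inl hr)
    have hv₂ : s₂.vars = s₁.vars := State.vars_congr fun r hr => hkeep₂ r (Or.inl hr)
    refine ⟨_, (h₁.seq (h₂.seq (Exec.store _ _ _ _))).cast (by simp [cost, h0]), ?_, ?_⟩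
    · refine Prod.ext (hv₂.trans hv₁) ?_
      simp only [run]
      rw [State.setArr_arr, hval₂, hkeep₂ _ (by omega), hval₁, harr₂, harr₁, h0, hv₁]
    · intro r hr hr'
      rw [State.setArr_reg, hkeep₂ r (by omega), hkeep₁ r (by omega)]
  | seq p q hp hq =>
    intro k s
    obtain ⟨s₁, h₁, hrun₁, hkeep₁⟩ := hp k s
    obtain ⟨s₂, h₂, hrun₂, hkeep₂⟩ := hq k s₁
    have h0 : s₁.reg 0 = s.reg 0 := hkeep₁ 0 (by omega) (by omega)
    refine ⟨s₂, (h₁.seq h₂).cast (by simp [cost, h0]), ?_, fun r hr hr' => ?_⟩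
    · rw [hrun₂, hrun₁, h0, run]
    · rw [hkeep₂ r hr hr', hkeep₁ r hr hr']
  | rep p hp =>
    intro k s
    have hloop : ∀ (m : ℕ) (s : State), s.reg (2 * k + 2) = m → ∃ s' : State,
        Exec (.loop (2 * k + 2) (.seq (compile p (k + 1)) (.seq (.const (2 * (k + 1) + 2) 1)
          (.sub (2 * k + 2) (2 * k + 2) (2 * (k + 1) + 2))))) s
          (m * (p.cost.eval (s.reg 0) + 3) + 1) s' ∧
        (s'.vars, s'.arr) = (p.run (s.reg 0))^[m] (s.vars, s.arr) ∧
        ∀ r, r % 2 = 0 → r < 2 * k + 2 → s'.reg r = s.reg r := by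
      intro m
      induction m with
      | zero => exact fun s hs => ⟨s, (Exec.loop_zero hs).cast (by simp), rfl, fun _ _ _ => rfl⟩
      | succ m ih =>
        intro s hs
        obtain ⟨s₁, h₁, hrun₁, hkeep₁⟩ := hp (k + 1) s
        let s₂ := s₁.setReg (2 * (k + 1) + 2) 1
        let s₃ := s₂.setReg (2 * k + 2) (s₂.reg (2 * k + 2) - s₂.reg (2 * (k + 1) + 2))
        have hreg : ∀ r, r % 2 = 1 ∨ r < 2 * k + 2 → s₃.reg r = s₁.reg r := by
          intro r hr
          simp only [s₃, s₂]
          rw [State.setReg_reg, if_neg (by omega), State.setReg_reg, if_neg (by omega)]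
        have hcnt : s₃.reg (2 * k + 2) = m := by
          simp [s₃, s₂, State.setReg_reg]
          rw [hkeep₁ _ (by omega) (by omega), hs]
          rfl
        have hv : s₃.vars = s₁.vars := State.vars_congr fun r hr => hreg r (Or.inl hr)
        have h0 : s₃.reg 0 = s.reg 0 := by
          rw [hreg 0 (by omega), hkeep₁ 0 (by omega) (by omega)]
        obtain ⟨s₄, h₄, hrun₄, hkeep₄⟩ := ih s₃ hcnt
        refine ⟨s₄, (Exec.loop_pos (by omega)
          (h₁.seq ((Exec.const _ _ _).seq (Exec.sub _ _ _ _))) h₄).cast ?_, ?_, ?_⟩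
        · rw [h0]; ring
        · rw [hrun₄, h0, Function.iterate_succ_apply, ← hrun₁, hv]
          rfl
        · intro r hr hr'
          rw [hkeep₄ r hr hr', hreg r (by omega), hkeep₁ r hr (by omega)]
    obtain ⟨s', h', hrun', hkeep'⟩ := hloop (s.reg 0) (s.setReg (2 * k + 2) (s.reg 0))
      (by simp [State.setReg_reg])
    have h0 : (s.setReg (2 * k + 2) (s.reg 0)).reg 0 = s.reg 0 := by
      rw [State.setReg_reg, if_neg (by omega)]
    refine ⟨s', ((Exec.copy _ _ _).seq h').cast ?_, ?_, ?_⟩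
    · rw [h0]; simp [cost]; ring
    · rw [hrun', h0, State.vars_congr (s := s), run]
      · rfl
      · intro r hr
        rw [State.setReg_reg, if_neg (by omega)]
    · intro r hr hr'
      rw [hkeep' r hr hr', State.setReg_reg, if_neg (by omega)]

end Stmt

theorem length_le_inputSize (l : List ℕ) : l.length ≤ inputSize l := by
  induction l with
  | nil => simp [inputSize]
  | cons a l ih =>
    simp only [inputSize, List.map_cons, List.sum_cons, List.length_cons] at ih ⊢
    omega

/-- The input array: array `0` holds the list `l`, all other cells are `0`. -/
def inputArr (l : List ℕ) : ℕ → ℕ → ℕ := (initState l).arr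

/-- A statement followed by the evaluation of an expression decides a property in polynomial time,
when the loop bound is the first entry of the input and at most the length of the input. -/
theorem DecidableInPolyTime.of_stmt {α : Type*} {enc : α → List ℕ} {P : α → Prop} (p : Stmt)
    (e : Exp) (hlen : ∀ a, (enc a).getD 0 0 ≤ (enc a).length)
    (hpos : ∀ a, P a → e.eval ((enc a).getD 0 0)
      (p.run ((enc a).getD 0 0) (fun _ => 0, inputArr (enc a))).2
      (p.run ((enc a).getD 0 0) (fun _ => 0, inputArr (enc a))).1 = 1)
    (hneg : ∀ a, ¬ P a → e.eval ((enc a).getD 0 0)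
      (p.run ((enc a).getD 0 0) (fun _ => 0, inputArr (enc a))).2
      (p.run ((enc a).getD 0 0) (fun _ => 0, inputArr (enc a))).1 = 0) :
    DecidableInPolyTime enc P := by
  -- Register `1` is initially 0, so the load replaces the input length in register `0` by the first
  -- entry, the loop bound. The value of `e` arrives in register `2`.
  refine ⟨.seq (.load 0 0 1) (.seq (p.compile 0) (.seq (e.compile 0) (.copy 0 2))),
    1 + (p.cost + (e.cost + 1)), fun a => ?_⟩
  let s₁ := (initState (enc a)).setReg 0 ((enc a).getD 0 0)
  have h0 : s₁.reg 0 = (enc a).getD 0 0 := by simp [s₁, State.setReg_reg]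
  have hv : s₁.vars = fun _ => 0 := by
    funext x
    rw [State.vars, State.setReg_reg, if_neg (by omega)]
    simp [initState]
  have harr : s₁.arr = inputArr (enc a) := rfl
  obtain ⟨s₂, h₂, hrun₂, hkeep₂⟩ := p.compile_correct 0 s₁
  obtain ⟨s₃, h₃, -, hval₃, -⟩ := e.correct 0 s₂
  have h0' : s₂.reg 0 = s₁.reg 0 := hkeep₂ 0 (by omega) (by omega)
  have hval : (s₃.setReg 0 (s₃.reg 2)).reg 0 = e.eval ((enc a).getD 0 0)
      (p.run ((enc a).getD 0 0) (fun _ => 0, inputArr (enc a))).2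
      (p.run ((enc a).getD 0 0) (fun _ => 0, inputArr (enc a))).1 := by
    rw [State.setReg_reg, if_pos rfl, hval₃, h0', h0, ← h0, ← hv, ← harr, ← hrun₂]
  have h₁ : Exec (.load 0 0 1) (initState (enc a)) 1 s₁ := Exec.load _ _ _ _
  refine ⟨_, _, h₁.seq (h₂.seq (h₃.seq (Exec.copy _ _ _))), ?_,
    fun h => hval.trans (hpos a h), fun h => hval.trans (hneg a h)⟩
  · rw [h0', h0]
    -- Polynomials with natural coefficients are monotone.
    have hmono : (1 + (p.cost + (e.cost + 1))).eval ((enc a).getD 0 0) ≤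
        (1 + (p.cost + (e.cost + 1))).eval (inputSize (enc a)) := by
      generalize 1 + (p.cost + (e.cost + 1)) = q
      have hle := (hlen a).trans (length_le_inputSize (enc a))
      rw [Polynomial.eval_eq_sum, Polynomial.eval_eq_sum]
      exact Finset.sum_le_sum fun i _ => Nat.mul_le_mul_left _ (Nat.pow_le_pow_left hle i)
    refine le_trans (le_of_eq ?_) hmono
    simp

end RAM

/-! ### The auction algorithm for bipartite matchings

Bidders `U` and items `S` are joined by `E`. An unassigned bidder takes the cheapest item it is
joined to, whose price then goes up by one, and whose former owner becomes unassigned. The owner of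
an item is stored as a number, with `0` for no owner and `u + 1` for the bidder `u`. -/

namespace Auction

variable {n : ℕ} (U S : Finset (Fin n)) (E : Fin n → Fin n → Prop)

/-- The bidder `u` owns no item. -/
def Unassigned (o : Fin n → ℕ) (u : Fin n) : Prop := u ∈ U ∧ ∀ s ∈ S, o s ≠ u + 1

/-- The invariant of the algorithm. -/
structure Inv (o p : Fin n → ℕ) : Prop where
  owned_of_price : ∀ s ∈ S, p s ≠ 0 → o s ≠ 0
  owner_lt : ∀ s ∈ S, o s ≤ n
  owner : ∀ s ∈ S, ∀ u : Fin n, o s = u + 1 → E u s ∧ ∀ s', E u s' → p s ≤ p s' + 1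
  inj : ∀ s ∈ S, ∀ t ∈ S, o s ≠ 0 → o s = o t → s = t

/-- One round of the algorithm, described on the items only. -/
def Step (o p o' p' : Fin n → ℕ) : Prop :=
  (∃ u s, Unassigned U S o u ∧ E u s ∧ (∀ s', E u s' → p s ≤ p s') ∧
    ∀ t ∈ S, (o' t = if t = s then (u : ℕ) + 1 else o t) ∧
      p' t = if t = s then p t + 1 else p t) ∨
  ((∀ t ∈ S, o' t = o t ∧ p' t = p t) ∧
    ((∀ u, ¬ Unassigned U S o u) ∨ ∃ u ∈ U, ∀ s, ¬ E u s))

variable {U S E} {o p o' p' : Fin n → ℕ}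

theorem Inv.exists_owner (h : Inv S E o p) {s : Fin n} (hs : s ∈ S) (ho : o s ≠ 0) :
    ∃ u : Fin n, o s = u + 1 :=
  ⟨⟨o s - 1, by have := h.owner_lt s hs; omega⟩, by simp only; omega⟩

/-- The buyer takes a cheapest item and raises its price by one, so it stays within one of every
alternative. Later this persists, since other prices never fall and an item's own price rises only
when it changes hands. -/
theorem Inv.step (hE : ∀ u s, E u s → u ∈ U ∧ s ∈ S) (h : Inv S E o p)
    (hstep : Step U S E o p o' p') : Inv S E o' p' := by
  rcases hstep with ⟨u, s, hu, hus, hmin, hnew⟩ | ⟨hsame, -⟩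
  · have hp : ∀ t ∈ S, p t ≤ p' t := fun t ht => by
      rw [(hnew t ht).2]; split_ifs <;> omega
    refine ⟨fun t ht => ?_, fun t ht => ?_, fun t ht w => ?_, fun t ht t' ht' => ?_⟩
    · rw [(hnew t ht).1, (hnew t ht).2]
      split_ifs
      · omega
      · exact h.owned_of_price t ht
    · rw [(hnew t ht).1]
      split_ifs
      · exact u.2
      · exact h.owner_lt t ht
    · rw [(hnew t ht).1, (hnew t ht).2]
      split_ifs with hts
      · intro hw
        have hw' : w = u := Fin.ext (by omega)
        subst hw' hts
        exact ⟨hus, fun s' hs' => Nat.succ_le_succ ((hmin s' hs').trans (hp s' (hE _ _ hs').2))⟩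
      · intro hw
        obtain ⟨h₁, h₂⟩ := h.owner t ht w hw
        exact ⟨h₁, fun s' hs' => (h₂ s' hs').trans (Nat.succ_le_succ (hp s' (hE _ _ hs').2))⟩
    · rw [(hnew t ht).1, (hnew t' ht').1]
      split_ifs with h₁ h₂ h₂
      · exact fun _ _ => h₁.trans h₂.symm
      · exact fun _ h' => absurd h'.symm (hu.2 t' ht')
      · exact fun _ h' => absurd h' (hu.2 t ht)
      · exact h.inj t ht t' ht'
  · refine ⟨fun t ht => ?_, fun t ht => ?_, fun t ht w => ?_, fun t ht t' ht' => ?_⟩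
    · rw [(hsame t ht).1, (hsame t ht).2]
      exact h.owned_of_price t ht
    · rw [(hsame t ht).1]
      exact h.owner_lt t ht
    · rw [(hsame t ht).1, (hsame t ht).2]
      intro hw
      obtain ⟨h₁, h₂⟩ := h.owner t ht w hw
      exact ⟨h₁, fun s' hs' => by rw [(hsame s' (hE _ _ hs').2).2]; exact h₂ s' hs'⟩
    · rw [(hsame t ht).1, (hsame t' ht').1]
      exact h.inj t ht t' ht'

/-- If there is a perfect matching, an unassigned bidder is joined to an item of low price:
otherwise some price is missing, and the owners of the items above it violate Hall's condition. -/
theorem Inv.exists_price_lt (hE : ∀ u s, E u s → u ∈ U ∧ s ∈ S) (h : Inv S E o p)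
    {f : Fin n → Fin n} (hf : Set.BijOn f U S) (hfE : ∀ u ∈ U, E u (f u)) {u : Fin n}
    (hu : Unassigned U S o u) : ∃ s, E u s ∧ p s < S.card := by
  classical
  by_contra! hbig
  have hcard : U.card = S.card := Finset.card_nbij f hf.mapsTo hf.injOn hf.surjOn
  have howner : ∀ s ∈ S, o s ≠ 0 → ∃ w ∈ U, o s = (w : ℕ) + 1 := by
    intro s hs ho
    obtain ⟨w, hw⟩ := h.exists_owner hs ho
    exact ⟨w, (hE _ _ (h.owner s hs w hw).1).1, hw⟩
  -- Were every item owned, the owners would be |S| distinct bidders other than u, although |U| =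
  -- |S|.
  obtain ⟨s₀, hs₀, ho₀⟩ : ∃ s ∈ S, o s = 0 := by
    by_contra! hall
    choose! g hgU hg using fun s hs => howner s hs (hall s hs)
    have : S.card ≤ (U.erase u).card := by
      refine Finset.card_le_card_of_injOn g (fun s hs => ?_) fun s hs s' hs' hss => ?_
      · exact Finset.mem_erase.2 ⟨fun hgu => hu.2 s hs (by rw [hg s hs, hgu]), hgU s hs⟩
      · exact h.inj s hs s' hs' (hall s hs) (by rw [hg s hs, hg s' hs', hss])
    rw [Finset.card_erase_of_mem hu.1] at this
    have := Finset.card_pos.2 ⟨u, hu.1⟩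
    omega
  have hp₀ : p s₀ = 0 := by
    by_contra hne
    exact h.owned_of_price s₀ hs₀ hne ho₀
  -- The items other than the free one, whose price is 0, take at most |S| - 1 values, so some k in
  -- 1, …, |S| is nobody's price.
  obtain ⟨k, hk, hkp⟩ : ∃ k ∈ Finset.Icc 1 S.card, k ∉ (S.erase s₀).image p := by
    apply Finset.exists_mem_notMem_of_card_lt_card
    refine lt_of_le_of_lt Finset.card_image_le ?_
    rw [Finset.card_erase_of_mem hs₀, Nat.card_Icc]
    have := Finset.card_pos.2 ⟨s₀, hs₀⟩
    omega
  rw [Finset.mem_Icc] at hk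
  have hk' : ∀ s ∈ S, p s ≠ k := by
    intro s hs hsk
    by_cases hss : s = s₀
    · rw [hss, hp₀] at hsk
      omega
    · exact hkp (Finset.mem_image.2 ⟨s, Finset.mem_erase.2 ⟨hss, hs⟩, hsk⟩)
  let A := S.filter fun s => k ≤ p s
  have hA : ∀ s ∈ A, s ∈ S ∧ k ≤ p s := fun s hs => Finset.mem_filter.1 hs
  have hAo : ∀ s ∈ A, o s ≠ 0 := fun s hs =>
    h.owned_of_price s (hA s hs).1 (by have := (hA s hs).2; omega)
  choose! g hgU hg using fun s (hs : s ∈ A) => howner s (hA s hs).1 (hAo s hs)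
  have huA : u ∉ A.image g := by
    rw [Finset.mem_image]
    rintro ⟨s, hs, hgs⟩
    exact hu.2 s (hA s hs).1 (by rw [hg s hs, hgs])
  have hginj : Set.InjOn g A := fun s hs s' hs' hss =>
    h.inj s (hA s hs).1 s' (hA s' hs').1 (hAo s hs) (by rw [hg s hs, hg s' hs', hss])
  -- An owner of an item in A has price at least k + 1 there, so all its alternatives cost at least
  -- k; those of u cost at least |S|. Thus f maps |A| + 1 bidders injectively into A.
  have hle : (insert u (A.image g)).card ≤ A.card := by
    refine Finset.card_le_card_of_injOn f (fun w hw => ?_) (hf.injOn.mono fun w hw => ?_)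
    · rw [Finset.coe_insert, Set.mem_insert_iff, Finset.mem_coe, Finset.mem_image] at hw
      rcases hw with rfl | ⟨s, hs, rfl⟩
      · exact Finset.mem_filter.2 ⟨hf.mapsTo hu.1, hk.2.trans (hbig _ (hfE w hu.1))⟩
      · have h₁ := (h.owner s (hA s hs).1 _ (hg s hs)).2 _ (hfE _ (hgU s hs))
        have h₂ := hk' s (hA s hs).1
        have h₃ := (hA s hs).2
        exact Finset.mem_filter.2 ⟨hf.mapsTo (hgU s hs), by omega⟩
    · rw [Finset.coe_insert, Set.mem_insert_iff, Finset.mem_coe, Finset.mem_image] at hw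
      rcases hw with rfl | ⟨s, hs, rfl⟩
      · exact hu.1
      · exact hgU s hs
  rw [Finset.card_insert_of_notMem huA, Finset.card_image_of_injOn hginj] at hle
  omega

/-- After sufficiently many rounds everything is assigned if and only if there is a perfect
matching. -/
theorem exists_bijOn_iff (hE : ∀ u s, E u s → u ∈ U ∧ s ∈ S) (O P : ℕ → Fin n → ℕ)
    (hO : ∀ s ∈ S, O 0 s = 0) (hP : ∀ s ∈ S, P 0 s = 0) {K : ℕ}
    (hstep : ∀ t < K, Step U S E (O t) (P t) (O (t + 1)) (P (t + 1))) (hK : n * n < K) :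
    (∃ f : Fin n → Fin n, Set.BijOn f U S ∧ ∀ u ∈ U, E u (f u)) ↔
      (∀ u ∈ U, ∃ s ∈ S, O K s = u + 1) ∧ ∀ s ∈ S, O K s ≠ 0 := by
  have hinv : ∀ t ≤ K, Inv S E (O t) (P t) := by
    intro t
    induction t with
    | zero =>
      refine fun _ => ⟨fun s hs h => absurd (hP s hs) h, fun s hs => by simp [hO s hs],
        fun s hs u h => ?_, fun s hs s' hs' h => absurd (hO s hs) h⟩
      rw [hO s hs] at h
      omega
    | succ t ih => exact fun ht => (ih (by omega)).step hE (hstep t ht)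
  constructor
  · rintro ⟨f, hf, hfE⟩
    -- While some bidder is unassigned no round is idle, so t rounds have raised the sum of the
    -- prices to at least t.
    have hprice : ∀ t ≤ K, (∀ s ∈ S, P t s ≤ S.card) ∧
        ∀ u, Unassigned U S (O t) u → t ≤ ∑ s ∈ S, P t s := by
      intro t
      induction t with
      | zero => exact fun _ => ⟨fun s hs => by simp [hP s hs], fun _ _ => Nat.zero_le _⟩
      | succ t ih =>
        intro ht
        obtain ⟨h₁, h₂⟩ := ih (by omega)
        rcases hstep t ht with ⟨u, s, hu, hus, hmin, hnew⟩ | ⟨hsame, hno⟩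
        · have hsS := (hE u s hus).2
          constructor
          · intro t' ht'
            rw [(hnew t' ht').2]
            split_ifs with hts
            · subst hts
              obtain ⟨x, hx, hlt⟩ := (hinv t (by omega)).exists_price_lt hE hf hfE hu
              exact (hmin x hx).trans_lt hlt
            · exact h₁ t' ht'
          · intro _ _
            have : ∑ x ∈ S, P t x < ∑ x ∈ S, P (t + 1) x := by
              refine Finset.sum_lt_sum (fun x hx => ?_) ⟨s, hsS, ?_⟩
              · rw [(hnew x hx).2]; split_ifs <;> omega
              · rw [(hnew s hsS).2, if_pos rfl]; omega
            have := h₂ u hu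
            omega
        · refine ⟨fun s hs => (hsame s hs).2 ▸ h₁ s hs, fun u hu => ?_⟩
          rcases hno with hno | ⟨w, hw, hno⟩
          · exact absurd ⟨hu.1, fun s hs => (hsame s hs).1 ▸ hu.2 s hs⟩ (hno u)
          · exact absurd (hfE w hw) (hno _)
    have hU : ∀ u ∈ U, ∃ s ∈ S, O K s = u + 1 := by
      by_contra! hcon
      obtain ⟨u, hu, hun⟩ := hcon
      obtain ⟨h₁, h₂⟩ := hprice K le_rfl
      have h₃ := h₂ u ⟨hu, hun⟩
      have h₄ := Finset.sum_le_card_nsmul S (P K) S.card h₁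
      have h₅ : S.card ≤ n := by simpa using Finset.card_le_univ S
      have h₆ : S.card * S.card ≤ n * n := Nat.mul_le_mul h₅ h₅
      exact absurd hK (not_lt.2 (h₃.trans (h₄.trans h₆)))
    refine ⟨hU, ?_⟩
    choose! g hgS hg using hU
    have hginj : Set.InjOn g U := fun u hu u' hu' huu => by
      have h₁ := hg u hu
      rw [huu, hg u' hu'] at h₁
      exact Fin.ext (by omega)
    have hcard : U.card = S.card := Finset.card_nbij f hf.mapsTo hf.injOn hf.surjOn
    -- Each bidder owns an item and |U| = |S|, so each item is owned.
    have hsurj : Set.SurjOn g U S := Finset.surjOn_of_injOn_of_card_le g hgS hginj hcard.ge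
    intro s hs
    obtain ⟨u, hu, rfl⟩ := hsurj hs
    rw [hg u hu]
    omega
  -- Here the number of rounds is irrelevant: by the invariant the final ownership is itself a
  -- perfect matching.
  · rintro ⟨hU, hS⟩
    have hK' := hinv K le_rfl
    choose! g hgS hg using hU
    refine ⟨g, ⟨hgS, fun u hu u' hu' huu => ?_, fun s hs => ?_⟩,
      fun u hu => (hK'.owner _ (hgS u hu) u (hg u hu)).1⟩
    · have h₁ := hg u hu
      rw [huu, hg u' hu'] at h₁
      exact Fin.ext (by omega)
    · obtain ⟨u, hu⟩ := hK'.exists_owner hs (hS s hs)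
      have huU := (hE _ _ (hK'.owner s hs u hu).1).1
      exact ⟨u, huU, hK'.inj _ (hgS u huU) s hs (by rw [hg u huU]; omega) (by rw [hg u huU, hu])⟩

end Auction

/-! ### Bounded formulas and minimisation as expressions -/

namespace RAM.Exp

/-- Expressions as formulas: an expression holds if its value is not zero. -/
def Holds (n : ℕ) (A : ℕ → ℕ → ℕ) (e : Exp) (v : ℕ → ℕ) : Prop := e.eval n A v ≠ 0

/-- Negation. -/
def neg (e : Exp) : Exp := .sub (.const 1) e

/-- Conjunction, with value `0` or `1`. -/
def conj (e f : Exp) : Exp := .neg (.add (.neg e) (.neg f))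

/-- Implication. -/
def imp (e f : Exp) : Exp := .add (.neg e) f

/-- Bounded universal quantification. -/
def all (x : ℕ) (e : Exp) : Exp := .neg (.sum x (.neg e))

/-- The order relation. -/
def le (e f : Exp) : Exp := .neg (.sub e f)

/-- Equality. -/
def eq (e f : Exp) : Exp := .conj (.le e f) (.le f e)

/-- The least value of `x` for which `e` holds, or the bound if there is none; here `y` is an
auxiliary variable. -/
def find (x y : ℕ) (e : Exp) : Exp := .sum y (.neg (.sum x (.conj (.le (.var x) (.var y)) e)))

variable {n : ℕ} {A : ℕ → ℕ → ℕ} {e f : Exp} {v : ℕ → ℕ}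

@[simp]
theorem holds_neg : Holds n A (.neg e) v ↔ ¬ Holds n A e v := by
  simp only [Holds, neg, eval]; omega

@[simp]
theorem holds_add : Holds n A (.add e f) v ↔ Holds n A e v ∨ Holds n A f v := by
  simp only [Holds, eval]; omega

@[simp]
theorem holds_conj : Holds n A (.conj e f) v ↔ Holds n A e v ∧ Holds n A f v := by
  simp only [conj, holds_neg, holds_add]; tauto

@[simp]
theorem holds_imp : Holds n A (.imp e f) v ↔ (Holds n A e v → Holds n A f v) := by
  simp only [imp, holds_neg, holds_add]; tauto

@[simp]
theorem holds_sum {x : ℕ} :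
    Holds n A (.sum x e) v ↔ ∃ i : Fin n, Holds n A e (Function.update v x i) := by
  simp only [Holds, eval, ne_eq, Finset.sum_eq_zero_iff, Finset.mem_range, not_forall]
  exact ⟨fun ⟨i, hi, h⟩ => ⟨⟨i, hi⟩, h⟩, fun ⟨i, h⟩ => ⟨i, i.2, h⟩⟩

@[simp]
theorem holds_all {x : ℕ} :
    Holds n A (.all x e) v ↔ ∀ i : Fin n, Holds n A e (Function.update v x i) := by
  simp [all]

@[simp]
theorem holds_le : Holds n A (.le e f) v ↔ e.eval n A v ≤ f.eval n A v := by
  simp only [Holds, le, neg, eval]; omega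

@[simp]
theorem holds_eq : Holds n A (.eq e f) v ↔ e.eval n A v = f.eval n A v := by
  simp only [eq, holds_conj, holds_le]; omega

/-- The machine must answer exactly 1, not merely a nonzero number. -/
theorem eval_conj_of_holds (h : Holds n A (.conj e f) v) : (Exp.conj e f).eval n A v = 1 := by
  simp only [Holds, conj, neg, eval] at h ⊢; omega

theorem eval_neg_eq_ite [Decidable (Holds n A e v)] :
    (Exp.neg e).eval n A v = if Holds n A e v then 0 else 1 := by
  split_ifs with h
  · simp only [Holds, neg, eval] at h ⊢; omega
  · simp only [Holds, neg, eval] at h ⊢; omega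

theorem eval_find {x y : ℕ} (hxy : y ≠ x) (Q : Fin n → Prop)
    (hQ : ∀ (i : Fin n) (j : ℕ),
      Holds n A e (Function.update (Function.update v y j) x i) ↔ Q i) :
    (∃ i : Fin n, Q i ∧ (find x y e).eval n A v = i) ∨
      ((∀ i, ¬ Q i) ∧ (find x y e).eval n A v = n) := by
  classical
  -- The summand at j is 1 exactly when no witness is at most j, so the sum counts the numbers below
  -- the least witness, or all n if there is none.
  have hterm : ∀ j, (Exp.neg (.sum x (.conj (.le (.var x) (.var y)) e))).eval n A
      (Function.update v y j) = if ∃ i : Fin n, (i : ℕ) ≤ j ∧ Q i then 0 else 1 := by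
    intro j
    rw [eval_neg_eq_ite]
    simp [eval, hQ, Function.update_of_ne hxy]
  simp only [find, eval, hterm]
  by_cases hex : ∃ i, Q i
  · left
    have hex' : ∃ m, ∃ h : m < n, Q ⟨m, h⟩ := hex.elim fun i hi => ⟨i, i.2, hi⟩
    let i₀ := Nat.find hex'
    obtain ⟨hlt, hi₀⟩ : ∃ h : i₀ < n, Q ⟨i₀, h⟩ := Nat.find_spec hex'
    have hiff : ∀ j, (∃ i : Fin n, (i : ℕ) ≤ j ∧ Q i) ↔ i₀ ≤ j := by
      intro j
      constructor
      · rintro ⟨i, hij, hi⟩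
        exact (Nat.find_min' hex' ⟨i.2, hi⟩).trans hij
      · exact fun h => ⟨⟨i₀, hlt⟩, h, hi₀⟩
    refine ⟨⟨i₀, hlt⟩, hi₀, ?_⟩
    simp only [hiff]
    have : ∀ j, (if i₀ ≤ j then 0 else 1) = if j ∈ Finset.range i₀ then 1 else 0 := by
      intro j
      simp only [Finset.mem_range]
      split_ifs <;> omega
    simp only [this]
    rw [Finset.sum_ite_mem, Finset.inter_eq_right.2 (Finset.range_subset_range.2 hlt.le)]
    simp
  · right
    push Not at hex
    refine ⟨hex, ?_⟩
    simp [hex]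

end RAM.Exp

namespace BCol

open RAM

/-! ### Reading the input -/

theorem getD_flatMap {α : Type*} {m : ℕ} (f : α → List ℕ) (hf : ∀ a, (f a).length = m)
    (L : List α) (i j : ℕ) (hi : i < L.length) (hj : j < m) :
    (L.flatMap f).getD (m * i + j) 0 = (f L[i]).getD j 0 := by
  induction L generalizing i with
  | nil => simp at hi
  | cons a L ih =>
    rw [List.flatMap_cons]
    cases i with
    | zero => rw [List.getD_append _ _ _ _ (by rw [hf]; omega)]; simp
    | succ i =>
      rw [List.getD_append_right _ _ _ _ (by rw [hf]; nlinarith), hf,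
        show m * (i + 1) + j - m = m * i + j by rw [Nat.mul_succ]; omega,
        ih i (by simpa using hi)]
      simp

theorem length_flatMap_finRange {n : ℕ} (f : Fin n → Fin n → ℕ) :
    ((List.finRange n).flatMap fun i => (List.finRange n).map (f i)).length = n * n := by
  simp [List.length_flatMap]

theorem getD_map_finRange {n : ℕ} (f : Fin n → ℕ) (v : Fin n) :
    ((List.finRange n).map f).getD v 0 = f v := by
  rw [List.getD_eq_getElem _ _ (by simp)]
  simp

section Encoding

variable (I : Instance)

theorem encode_getD_zero : I.encode.getD 0 0 = I.n := by
  simp [Instance.encode]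

theorem encode_length : I.encode.length = 1 + I.n * I.n + I.n + I.n := by
  classical
  unfold Instance.encode
  rw [List.length_append, List.length_append, List.length_append, length_flatMap_finRange]
  simp

open Classical in
theorem encode_getD_adj (x y : Fin I.n) :
    I.encode.getD (1 + I.n * x + y) 0 = if I.G.Adj x y then 1 else 0 := by
  have hlt : I.n * x + y < I.n * I.n := by
    have := Nat.mul_le_mul_left I.n (Nat.succ_le_of_lt x.2)
    rw [Nat.mul_succ] at this
    omega
  unfold Instance.encode
  rw [List.getD_append _ _ _ _ (by
      rw [List.length_append, List.length_append, length_flatMap_finRange]; simp; omega),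
    List.getD_append _ _ _ _ (by
      rw [List.length_append, length_flatMap_finRange]; simp; omega),
    List.getD_append_right _ _ _ _ (by simp; omega)]
  rw [show 1 + I.n * x + y - [I.n].length = I.n * x + y by simp; omega,
    getD_flatMap _ (by simp) _ _ _ (by simp) y.2, getD_map_finRange]
  simp

open Classical in
theorem encode_getD_mem (x : Fin I.n) :
    I.encode.getD (1 + I.n * I.n + x) 0 = if x ∈ I.S' then 1 else 0 := by
  unfold Instance.encode
  rw [List.getD_append _ _ _ _ (by
      rw [List.length_append, List.length_append, length_flatMap_finRange]; simp),
    List.getD_append_right _ _ _ _ (by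
      rw [List.length_append, length_flatMap_finRange]; simp)]
  rw [List.length_append, length_flatMap_finRange,
    show 1 + I.n * I.n + x - ([I.n].length + I.n * I.n) = x by simp, getD_map_finRange]

open Classical in
theorem encode_getD_colour (x : Fin I.n) :
    I.encode.getD (1 + I.n * I.n + I.n + x) 0 =
      if h : x ∈ I.S' ∪ denseSet I.G then (I.c' ⟨x, h⟩ : ℕ) else 0 := by
  unfold Instance.encode
  rw [List.getD_append_right _ _ _ _ (by
      rw [List.length_append, List.length_append, length_flatMap_finRange]; simp)]
  rw [List.length_append, List.length_append, length_flatMap_finRange, List.length_map,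
    List.length_finRange, show 1 + I.n * I.n + I.n + x - ([I.n].length + I.n * I.n + I.n) = x by
      simp, getD_map_finRange]

end Encoding

end BCol

namespace BCol

open RAM

/-! ### The formulas that describe the auxiliary graph -/

namespace Formula

/-- Adjacency of the vertices `a` and `b`. -/
def adj (a b : ℕ) : Exp := .arr 0 (.add (.add (.const 1) (.sum 0 (.var a))) (.var b))

/-- Membership in `S'`. -/
def memS (a : ℕ) : Exp := .arr 0 (.add (.add (.const 1) (.sum 0 .bound)) (.var a))

/-- The colour of a vertex, or `0`. -/
def colour (a : ℕ) : Exp :=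
  .arr 0 (.add (.add (.add (.const 1) (.sum 0 .bound)) .bound) (.var a))

/-- Membership in the set of dense vertices, which are the coloured vertices outside `S'`. -/
def dense (a : ℕ) : Exp := .conj (colour a) (.neg (memS a))

/-- Membership in `T₁`. -/
def memT₁ (a : ℕ) : Exp :=
  .conj (dense a)
    (.all 10 (.imp (dense 10) (.imp (.neg (.eq (.var 10) (.var a))) (adj 10 a))))

/-- Membership in `T'`. -/
def memT' (a : ℕ) : Exp :=
  .conj (dense a) (.sum 11 (.conj (memS 11) (.eq (colour a) (colour 11))))

/-- Membership in `T₂`. -/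
def memT₂ (a : ℕ) : Exp := .conj (dense a) (.neg (.add (memT₁ a) (memT' a)))

/-- Membership in the outer boundary of the set of dense vertices, but not in `S'`. -/
def memB (a : ℕ) : Exp :=
  .conj (.conj (.sum 12 (.conj (dense 12) (adj 12 a))) (.neg (dense a))) (.neg (memS a))

/-- Adjacency in the auxiliary graph. -/
def auxAdj (a b : ℕ) : Exp :=
  .conj (.conj (memT₂ a) (memB b)) (.conj (.neg (adj a b))
    (.all 13 (.imp (.add (memT₂ 13) (memT' 13)) (.neg (.conj (adj a 13) (adj b 13))))))

/-- Every colour on `S'` is used on a dense vertex. -/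
def coloursUsed : Exp :=
  .all 1 (.imp (memS 1) (.sum 2 (.conj (dense 2) (.eq (colour 2) (colour 1)))))

theorem inputArr_zero (l : List ℕ) (i : ℕ) : inputArr l 0 i = l.getD i 0 := by
  simp [inputArr, initState]

variable {I : Instance} {A : ℕ → ℕ → ℕ} {v : ℕ → ℕ} {a b : ℕ} {x y : Fin I.n}

/-- The product of n and x in the row offset is an n-fold sum with bound variable `0`, so `a` must
differ from it. -/
theorem holds_adj (hA : A 0 = inputArr I.encode 0) (ha0 : a ≠ 0) (ha : v a = x) (hb : v b = y) :
    (adj a b).Holds I.n A v ↔ I.G.Adj x y := by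
  classical
  have h : (adj a b).eval I.n A v = if I.G.Adj x y then 1 else 0 := by
    simp only [adj, Exp.eval, Function.update_of_ne ha0, Finset.sum_const, Finset.card_range,
      smul_eq_mul]
    rw [hA, ha, hb, inputArr_zero, encode_getD_adj]
  rw [Exp.Holds, h]
  split_ifs with h' <;> simp [h']

theorem holds_memS (hA : A 0 = inputArr I.encode 0) (ha : v a = x) :
    (memS a).Holds I.n A v ↔ x ∈ I.S' := by
  classical
  have h : (memS a).eval I.n A v = if x ∈ I.S' then 1 else 0 := by
    simp only [memS, Exp.eval, Finset.sum_const, Finset.card_range, smul_eq_mul]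
    rw [hA, ha, inputArr_zero, encode_getD_mem]
  rw [Exp.Holds, h]
  split_ifs with h' <;> simp [h']

open Classical in
theorem eval_colour (hA : A 0 = inputArr I.encode 0) (ha : v a = x) :
    (colour a).eval I.n A v =
      if h : x ∈ I.S' ∪ denseSet I.G then (I.c' ⟨x, h⟩ : ℕ) else 0 := by
  simp only [colour, Exp.eval, Finset.sum_const, Finset.card_range, smul_eq_mul]
  rw [hA, ha, inputArr_zero, encode_getD_colour]

theorem eval_colour_eq_iff (hA : A 0 = inputArr I.encode 0) (ha : v a = x) (hb : v b = y)
    (hx : x ∈ I.S' ∪ denseSet I.G) (hy : y ∈ I.S' ∪ denseSet I.G) :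
    (colour a).eval I.n A v = (colour b).eval I.n A v ↔ I.c' ⟨x, hx⟩ = I.c' ⟨y, hy⟩ := by
  rw [eval_colour hA ha, eval_colour hA hb, dif_pos hx, dif_pos hy, PNat.coe_inj]

/-- Colours are positive and S' avoids T, so no degree has to be computed. -/
theorem holds_dense (hA : A 0 = inputArr I.encode 0) (ha : v a = x) :
    (dense a).Holds I.n A v ↔ x ∈ denseSet I.G := by
  rw [dense, Exp.holds_conj, Exp.holds_neg, holds_memS hA ha, Exp.Holds, eval_colour hA ha]
  by_cases hx : x ∈ I.S' ∪ denseSet I.G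
  · rw [dif_pos hx]
    simp only [ne_eq, PNat.ne_zero, not_false_eq_true, true_and]
    exact ⟨hx.resolve_left, fun h h' => (I.subset_boundary h').2 h⟩
  · rw [dif_neg hx]
    simp only [ne_eq, not_true_eq_false, false_and, false_iff]
    exact fun h => hx (Or.inr h)

theorem holds_memT₁ (hA : A 0 = inputArr I.encode 0) (h₀ : a ≠ 10) (ha : v a = x) :
    (memT₁ a).Holds I.n A v ↔ x ∈ T₁ I.G := by
  simp only [memT₁, Exp.holds_conj, Exp.holds_all, Exp.holds_imp, Exp.holds_neg, Exp.holds_eq,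
    Exp.eval, holds_dense hA ha]
  refine and_congr_right fun _ => forall_congr' fun w => ?_
  have h10 : Function.update v 10 (w : ℕ) 10 = w := Function.update_self _ _ _
  have ha' : Function.update v 10 (w : ℕ) a = x := by rw [Function.update_of_ne h₀, ha]
  rw [holds_dense hA h10, holds_adj hA (by norm_num) h10 ha', h10, ha', Fin.val_inj]

theorem holds_memT' (hA : A 0 = inputArr I.encode 0) (h₀ : a ≠ 11) (ha : v a = x) :
    (memT' a).Holds I.n A v ↔ x ∈ T' I.G I.S' I.c' := by
  simp only [memT', Exp.holds_conj, Exp.holds_sum, Exp.holds_eq, holds_dense hA ha]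
  have h11 : ∀ s : Fin I.n, Function.update v 11 (s : ℕ) 11 = s :=
    fun s => Function.update_self _ _ _
  have ha' : ∀ s : Fin I.n, Function.update v 11 (s : ℕ) a = x := fun s => by
    rw [Function.update_of_ne h₀, ha]
  constructor
  · rintro ⟨hx, s, hs, h⟩
    rw [holds_memS hA (h11 s)] at hs
    have hxm := Set.mem_union_right I.S' hx
    have hsm := Set.mem_union_left (denseSet I.G) hs
    rw [eval_colour_eq_iff hA (ha' s) (h11 s) hxm hsm] at h
    exact ⟨⟨x, hxm⟩, ⟨s, hsm⟩, rfl, hx, hs, h⟩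
  · rintro ⟨u, s, rfl, hx, hs, h⟩
    refine ⟨hx, s, (holds_memS hA (h11 s)).2 hs, ?_⟩
    exact (eval_colour_eq_iff hA (ha' s) (h11 s) u.2 s.2).2 h

theorem holds_memT₂ (hA : A 0 = inputArr I.encode 0) (h₁ : a ≠ 10) (h₂ : a ≠ 11) (ha : v a = x) :
    (memT₂ a).Holds I.n A v ↔ x ∈ T₂ I.G I.S' I.c' := by
  rw [memT₂, Exp.holds_conj, Exp.holds_neg, Exp.holds_add, holds_dense hA ha,
    holds_memT₁ hA h₁ ha, holds_memT' hA h₂ ha]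
  rfl

theorem holds_memB (hA : A 0 = inputArr I.encode 0) (h₀ : a ≠ 12) (ha : v a = x) :
    (memB a).Holds I.n A v ↔ x ∈ outerBoundary I.G (denseSet I.G) \ I.S' := by
  simp only [memB, Exp.holds_conj, Exp.holds_neg, Exp.holds_sum, holds_dense hA ha,
    holds_memS hA ha, outerBoundary, Set.mem_sdiff, Set.mem_iUnion, SimpleGraph.mem_neighborSet,
    exists_prop]
  refine and_congr_left fun _ => and_congr_left fun _ => exists_congr fun w => ?_
  have h12 : Function.update v 12 (w : ℕ) 12 = w := Function.update_self _ _ _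
  have ha' : Function.update v 12 (w : ℕ) a = x := by rw [Function.update_of_ne h₀, ha]
  rw [holds_dense hA h12, holds_adj hA (by norm_num) h12 ha']

/-- The edges of the auxiliary graph as a relation between vertices. -/
def AuxEdge (I : Instance) (x y : Fin I.n) : Prop :=
  (x ∈ T₂ I.G I.S' I.c' ∧ y ∈ outerBoundary I.G (denseSet I.G) \ I.S') ∧ AuxAdj I.G I.S' I.c' x y

/-- The range of `a` and `b` keeps them apart from the bound variables `0` and `10` to `13`. -/
theorem holds_auxAdj (hA : A 0 = inputArr I.encode 0) (ha' : 0 < a ∧ a < 10)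
    (hb' : 0 < b ∧ b < 10) (ha : v a = x) (hb : v b = y) :
    (auxAdj a b).Holds I.n A v ↔ AuxEdge I x y := by
  simp only [auxAdj, Exp.holds_conj, Exp.holds_neg, Exp.holds_all, Exp.holds_imp, Exp.holds_add]
  rw [holds_memT₂ hA (by omega) (by omega) ha, holds_memB hA (by omega) hb,
    holds_adj hA (by omega) ha hb, AuxEdge, AuxAdj]
  refine and_congr_right fun _ => and_congr_right fun _ => ?_
  refine forall_congr' fun w => ?_
  have h13 : Function.update v 13 (w : ℕ) 13 = w := Function.update_self _ _ _
  have hva : Function.update v 13 (w : ℕ) a = x := by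
    rw [Function.update_of_ne (by omega), ha]
  have hvb : Function.update v 13 (w : ℕ) b = y := by
    rw [Function.update_of_ne (by omega), hb]
  rw [holds_memT₂ hA (by norm_num) (by norm_num) h13, holds_memT' hA (by norm_num) h13,
    holds_adj hA (by omega) hva h13, holds_adj hA (by omega) hvb h13]
  -- The formula omits w ≠ x, since x is not adjacent to itself.
  exact ⟨fun h hw => h hw.1, fun h hw hadj => h ⟨hw, fun hwx => hadj.1.ne' hwx⟩ hadj⟩

theorem holds_coloursUsed (hA : A 0 = inputArr I.encode 0) :
    coloursUsed.Holds I.n A v ↔ ∀ s : ↥(I.S' ∪ denseSet I.G), (s : Fin I.n) ∈ I.S' →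
      ∃ u : ↥(I.S' ∪ denseSet I.G), (u : Fin I.n) ∈ denseSet I.G ∧ I.c' u = I.c' s := by
  simp only [coloursUsed, Exp.holds_all, Exp.holds_imp, Exp.holds_sum, Exp.holds_conj,
    Exp.holds_eq]
  have h1 : ∀ s : Fin I.n, Function.update v 1 (s : ℕ) 1 = s :=
    fun s => Function.update_self _ _ _
  have h1' : ∀ s u : Fin I.n, Function.update (Function.update v 1 (s : ℕ)) 2 (u : ℕ) 1 = s :=
    fun s u => by rw [Function.update_of_ne (by norm_num), h1]
  have h2 : ∀ s u : Fin I.n, Function.update (Function.update v 1 (s : ℕ)) 2 (u : ℕ) 2 = u :=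
    fun s u => Function.update_self _ _ _
  constructor
  · intro h s hs
    obtain ⟨u, hu, huc⟩ := h s ((holds_memS hA (h1 s)).2 hs)
    rw [holds_dense hA (h2 s u)] at hu
    have hum := Set.mem_union_right I.S' hu
    exact ⟨⟨u, hum⟩, hu, (eval_colour_eq_iff hA (h2 s u) (h1' s u) hum s.2).1 huc⟩
  · intro h s hs
    rw [holds_memS hA (h1 s)] at hs
    have hsm := Set.mem_union_left (denseSet I.G) hs
    obtain ⟨u, hu, huc⟩ := h ⟨s, hsm⟩ hs
    exact ⟨u, (holds_dense hA (h2 s u)).2 hu,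
      (eval_colour_eq_iff hA (h2 s u) (h1' s u) u.2 hsm).2 huc⟩

end Formula

end BCol

namespace BCol

open RAM

/-! ### The decision procedure -/

namespace Procedure

/-- The bidder in variable `1` owns no item; array `1` holds the owners. -/
def unassigned : Exp :=
  .conj (Formula.memT₂ 1) (.all 2 (.imp (Formula.memB 2)
    (.neg (.eq (.arr 1 (.var 2)) (.add (.var 1) (.const 1))))))

/-- The item in variable `2` is a cheapest one for the bidder in variable `1`; array `2` holds the
prices. -/
def cheapest : Exp :=
  .conj (.sub .bound (.var 1)) (.conj (Formula.auxAdj 1 2) (.all 4 (.imp (Formula.auxAdj 1 4)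
    (.le (.arr 2 (.var 2)) (.arr 2 (.var 4))))))

/-- One round of the auction. When there is no suitable bidder or item, it writes outside of the
part of the arrays that is ever read. -/
def round : Stmt :=
  .seq (.assign 1 (.find 1 3 unassigned)) <|
  .seq (.assign 2 (.find 2 3 cheapest)) <|
  .seq (.store 1 (.var 2) (.add (.var 1) (.const 1))) <|
  .store 2 (.var 2) (.add (.arr 2 (.var 2)) (.const 1))

/-- The auction. -/
def auction : Stmt := .seq (.rep (.rep round)) round

/-- The final test. -/
def accepts : Exp :=
  .conj Formula.coloursUsed (.conj
    (.all 1 (.imp (Formula.memT₂ 1) (.sum 2 (.conj (Formula.memB 2)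
      (.eq (.arr 1 (.var 2)) (.add (.var 1) (.const 1)))))))
    (.all 2 (.imp (Formula.memB 2) (.arr 1 (.var 2)))))

/-- The extra round after the double loop provides the strict inequality in
`Auction.exists_bijOn_iff`. -/
theorem run_auction (n : ℕ) (σ : (ℕ → ℕ) × (ℕ → ℕ → ℕ)) :
    auction.run n σ = (round.run n)^[n * n + 1] σ := by
  rw [Function.iterate_succ_apply', Function.iterate_mul]
  rfl

variable (I : Instance)

open Classical in
/-- The bidders. -/
noncomputable def bidders : Finset (Fin I.n) := {x | x ∈ T₂ I.G I.S' I.c'}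

open Classical in
/-- The items. -/
noncomputable def items : Finset (Fin I.n) :=
  {x | x ∈ outerBoundary I.G (denseSet I.G) \ I.S'}

variable {I}

theorem mem_bidders {x : Fin I.n} : x ∈ bidders I ↔ x ∈ T₂ I.G I.S' I.c' := by
  simp [bidders]

theorem mem_items {x : Fin I.n} :
    x ∈ items I ↔ x ∈ outerBoundary I.G (denseSet I.G) \ I.S' := by
  simp [items]

theorem mem_of_auxEdge (u s : Fin I.n) (h : Formula.AuxEdge I u s) :
    u ∈ bidders I ∧ s ∈ items I :=
  ⟨mem_bidders.2 h.1.1, mem_items.2 h.1.2⟩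

variable {A : ℕ → ℕ → ℕ} {v : ℕ → ℕ}

theorem holds_unassigned (hA : A 0 = inputArr I.encode 0) {x : Fin I.n} (hx : v 1 = x) :
    unassigned.Holds I.n A v ↔
      Auction.Unassigned (bidders I) (items I) (fun s => A 1 s) x := by
  simp only [unassigned, Exp.holds_conj, Exp.holds_all, Exp.holds_imp, Exp.holds_neg, Exp.holds_eq,
    Auction.Unassigned, mem_bidders, Formula.holds_memT₂ hA (by norm_num) (by norm_num) hx]
  refine and_congr_right fun _ => forall_congr' fun s => ?_
  have h2 : Function.update v 2 (s : ℕ) 2 = s := Function.update_self _ _ _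
  have h1 : Function.update v 2 (s : ℕ) 1 = x := by rw [Function.update_of_ne (by norm_num), hx]
  rw [Formula.holds_memB hA (by norm_num) h2, mem_items]
  simp only [Exp.eval, h1, h2, ne_eq]

theorem holds_cheapest (hA : A 0 = inputArr I.encode 0) {x s : Fin I.n} (hx : v 1 = x)
    (hs : v 2 = s) : cheapest.Holds I.n A v ↔
      Formula.AuxEdge I x s ∧ ∀ s' : Fin I.n, Formula.AuxEdge I x s' → A 2 s ≤ A 2 s' := by
  simp only [cheapest, Exp.holds_conj, Exp.holds_all, Exp.holds_imp, Exp.holds_le,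
    Formula.holds_auxAdj hA (a := 1) (b := 2) (by norm_num) (by norm_num) hx hs]
  have hlt : (Exp.sub .bound (.var 1)).Holds I.n A v := by
    simp only [Exp.Holds, Exp.eval, hx]
    have := x.2
    omega
  simp only [hlt, true_and]
  refine and_congr_right fun _ => forall_congr' fun t => ?_
  have h4 : Function.update v 4 (t : ℕ) 4 = t := Function.update_self _ _ _
  have h1 : Function.update v 4 (t : ℕ) 1 = x := by rw [Function.update_of_ne (by norm_num), hx]
  have h2 : Function.update v 4 (t : ℕ) 2 = s := by rw [Function.update_of_ne (by norm_num), hs]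
  rw [Formula.holds_auxAdj hA (by norm_num) (by norm_num) h1 h4]
  simp only [Exp.eval, h2, h4]

theorem run_round_snd (n : ℕ) (v : ℕ → ℕ) (A : ℕ → ℕ → ℕ) (u s : ℕ)
    (hu : (Exp.find 1 3 unassigned).eval n A v = u)
    (hs : (Exp.find 2 3 cheapest).eval n A (Function.update v 1 u) = s) :
    (round.run n (v, A)).2 0 = A 0 ∧
    (round.run n (v, A)).2 1 = Function.update (A 1) s (u + 1) ∧
    (round.run n (v, A)).2 2 = Function.update (A 2) s (A 2 s + 1) := by
  simp [round, Stmt.run, hu, hs, Exp.eval]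

theorem run_round (hA : A 0 = inputArr I.encode 0) :
    (round.run I.n (v, A)).2 0 = inputArr I.encode 0 ∧
    Auction.Step (bidders I) (items I) (Formula.AuxEdge I) (fun s => A 1 s) (fun s => A 2 s)
      (fun s => (round.run I.n (v, A)).2 1 s) (fun s => (round.run I.n (v, A)).2 2 s) := by
  obtain ⟨h0, h1, h2⟩ := run_round_snd I.n v A _ _ rfl rfl
  refine ⟨h0.trans hA, ?_⟩
  simp only [h1, h2]
  -- A failed search returns n, and cell n belongs to no vertex, so the stores have no effect on the
  -- items.
  have hidle : ∀ m, ∀ t ∈ items I, Function.update (A 1) I.n m t = A 1 t ∧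
      Function.update (A 2) I.n (A 2 I.n + 1) t = A 2 t := by
    intro m t _
    have ht : (t : ℕ) ≠ I.n := t.2.ne
    rw [Function.update_of_ne ht, Function.update_of_ne ht]
    exact ⟨rfl, rfl⟩
  rcases Exp.eval_find (n := I.n) (A := A) (v := v) (e := unassigned) (x := 1) (y := 3)
    (by norm_num) _ (fun i j => holds_unassigned hA (Function.update_self _ _ _)) with
    ⟨u, hu, hfu⟩ | ⟨hno, hfu⟩
  · rw [hfu]
    rcases Exp.eval_find (n := I.n) (A := A) (v := Function.update v 1 (u : ℕ)) (e := cheapest)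
      (x := 2) (y := 3) (by norm_num) _ (fun i j => holds_cheapest hA (x := u) (by
        rw [Function.update_of_ne (by norm_num), Function.update_of_ne (by norm_num),
          Function.update_self]) (Function.update_self _ _ _)) with
      ⟨s, hs, hfs⟩ | ⟨hno, hfs⟩
    · rw [hfs]
      refine Or.inl ⟨u, s, hu, hs.1, hs.2, fun t _ => ?_⟩
      simp only [Function.update_apply, Fin.val_inj]
      refine ⟨trivial, ?_⟩
      split_ifs with h
      · rw [h]
      · rfl
    · rw [hfs]
      refine Or.inr ⟨hidle _, Or.inr ⟨u, hu.1, fun s hs => ?_⟩⟩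
      -- If the bidder had any edge, a cheapest item would exist and the search would have
      -- succeeded.
      obtain ⟨t, ht, hmin⟩ := Set.exists_min_image {s | Formula.AuxEdge I u s} (fun s => A 2 s)
        (Set.toFinite _) ⟨s, hs⟩
      exact hno t ⟨ht, hmin⟩
  · rw [hfu]
    -- Without an unassigned bidder, variable `1` holds n, so the guard `.sub .bound (.var 1)` is 0
    -- and the search for an item fails too.
    rcases Exp.eval_find (n := I.n) (A := A) (v := Function.update v 1 I.n) (e := cheapest)
      (x := 2) (y := 3) (by norm_num) (fun _ => False) (fun i j => by
        simp [cheapest, Exp.Holds, Exp.eval, Exp.conj, Exp.neg]) with ⟨s, hs, -⟩ | ⟨-, hfs⟩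
    · exact hs.elim
    · rw [hfs]
      exact Or.inr ⟨hidle _, Or.inl hno⟩

theorem exists_bijective_iff_exists_bijOn :
    (∃ f : ↥(T₂ I.G I.S' I.c') → ↥(outerBoundary I.G (denseSet I.G) \ I.S'),
      Function.Bijective f ∧ ∀ u : ↥(T₂ I.G I.S' I.c'), AuxAdj I.G I.S' I.c' u (f u)) ↔
    ∃ f : Fin I.n → Fin I.n, Set.BijOn f (bidders I) (items I) ∧
      ∀ u ∈ bidders I, Formula.AuxEdge I u (f u) := by
  classical
  constructor
  · rintro ⟨f, hf, hadj⟩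
    let g : Fin I.n → Fin I.n := fun u => if h : u ∈ T₂ I.G I.S' I.c' then f ⟨u, h⟩ else u
    have hg : ∀ u (h : u ∈ T₂ I.G I.S' I.c'), g u = f ⟨u, h⟩ := fun u h => by
      simp only [g, dif_pos h]
    refine ⟨g, ⟨fun u hu => ?_, fun u hu u' hu' h => ?_, fun s hs => ?_⟩, fun u hu => ?_⟩
    · rw [hg u (mem_bidders.1 hu)]
      exact mem_items.2 (f _).2
    · rw [hg u (mem_bidders.1 hu), hg u' (mem_bidders.1 hu')] at h
      exact congrArg Subtype.val (hf.1 (Subtype.ext h))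
    · obtain ⟨u, hu⟩ := hf.2 ⟨s, mem_items.1 hs⟩
      exact ⟨u, mem_bidders.2 u.2, by rw [hg u u.2, hu]⟩
    · have hu' := mem_bidders.1 hu
      rw [hg u hu']
      exact ⟨⟨hu', (f _).2⟩, hadj ⟨u, hu'⟩⟩
  · rintro ⟨g, hg, hE⟩
    refine ⟨fun u => ⟨g u, mem_items.1 (hg.mapsTo (mem_bidders.2 u.2))⟩,
      ⟨fun u u' h => ?_, fun s => ?_⟩, fun u => (hE u (mem_bidders.2 u.2)).2⟩
    · exact Subtype.ext (hg.injOn (mem_bidders.2 u.2) (mem_bidders.2 u'.2)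
        (congrArg Subtype.val h))
    · obtain ⟨u, hu, h⟩ := hg.surjOn (mem_items.2 s.2)
      exact ⟨⟨u, mem_bidders.1 hu⟩, Subtype.ext h⟩

theorem holds_accepts (hA : A 0 = inputArr I.encode 0) : accepts.Holds I.n A v ↔
    (∀ s : ↥(I.S' ∪ denseSet I.G), (s : Fin I.n) ∈ I.S' →
      ∃ u : ↥(I.S' ∪ denseSet I.G), (u : Fin I.n) ∈ denseSet I.G ∧ I.c' u = I.c' s) ∧
    (∀ u ∈ bidders I, ∃ s ∈ items I, A 1 s = u + 1) ∧ ∀ s ∈ items I, A 1 s ≠ 0 := by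
  simp only [accepts, Exp.holds_conj, Exp.holds_all, Exp.holds_imp, Exp.holds_sum, Exp.holds_eq]
  rw [Formula.holds_coloursUsed hA]
  refine and_congr_right fun _ => and_congr (forall_congr' fun u => ?_) (forall_congr' fun s => ?_)
  · rw [Formula.holds_memT₂ hA (by norm_num) (by norm_num) (Function.update_self _ _ _),
      mem_bidders]
    refine imp_congr_right fun _ => exists_congr fun s => ?_
    rw [Formula.holds_memB hA (by norm_num) (Function.update_self _ _ _), mem_items]
    simp [Exp.eval]
  · rw [Formula.holds_memB hA (by norm_num) (Function.update_self _ _ _), mem_items]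
    simp [Exp.eval, Exp.Holds]

theorem holds_accepts_run :
    accepts.Holds I.n (auction.run I.n (fun _ => 0, inputArr I.encode)).2
      (auction.run I.n (fun _ => 0, inputArr I.encode)).1 ↔ I.HasExtension := by
  let σ : ℕ → (ℕ → ℕ) × (ℕ → ℕ → ℕ) := fun t =>
    (round.run I.n)^[t] (fun _ => 0, inputArr I.encode)
  have hσ : ∀ t, σ (t + 1) = round.run I.n (σ t) := fun t => Function.iterate_succ_apply' _ _ _
  have hinput : ∀ t, (σ t).2 0 = inputArr I.encode 0 := by
    intro t
    induction t with
    | zero => rfl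
    | succ t ih => rw [hσ]; exact (run_round ih).1
  have hzero : ∀ a ≠ 0, ∀ i, inputArr I.encode a i = 0 := fun a ha i => by
    simp [inputArr, initState, ha]
  rw [run_auction]
  change accepts.Holds I.n (σ (I.n * I.n + 1)).2 (σ (I.n * I.n + 1)).1 ↔ _
  rw [holds_accepts (hinput _), Instance.HasExtension,
    hasBPrecolouringExtension_iff_bijective I.isTight I.subset_boundary I.isPartial,
    exists_bijective_iff_exists_bijOn,
    Auction.exists_bijOn_iff mem_of_auxEdge (fun t s => (σ t).2 1 s) (fun t s => (σ t).2 2 s)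
      (fun s _ => hzero 1 (by norm_num) s) (fun s _ => hzero 2 (by norm_num) s)
      (K := I.n * I.n + 1) (fun t _ => ?_) (by omega)]
  simp only [hσ t]
  exact (run_round (hinput t)).2

end Procedure

theorem decidableInPolyTime_hasExtension :
    DecidableInPolyTime Instance.encode Instance.HasExtension := by
  refine DecidableInPolyTime.of_stmt Procedure.auction Procedure.accepts (fun I => ?_)
    (fun I hI => ?_) (fun I hI => ?_)
  · rw [encode_getD_zero, encode_length]
    omega
  · rw [encode_getD_zero]
    exact Exp.eval_conj_of_holds (Procedure.holds_accepts_run.2 hI)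
  · rw [encode_getD_zero]
    by_contra h
    exact hI (Procedure.holds_accepts_run.1 h)

end BCol

theorem mainTheorem4 :
    RAM.DecidableInPolyTime BCol.Instance.encode BCol.Instance.HasExtension ∧
    ∀ {V : Type*} [Finite V] (G : SimpleGraph V) (S' : Set V) (c' : BCol.PreColouring G S'),
      BCol.IsTight G → S' ⊆ BCol.outerBoundary G (BCol.denseSet G) →
      BCol.IsPartialBColouring G S' c' →
      (BCol.HasBPrecolouringExtension G S' c' ↔
        (∀ s : ↥(S' ∪ BCol.denseSet G), (s : V) ∈ S' →
          ∃ u : ↥(S' ∪ BCol.denseSet G), (u : V) ∈ BCol.denseSet G ∧ c' u = c' s) ∧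
        ∃ M : (BCol.auxGraph G S' c').Subgraph, M.IsPerfectMatching) := by
  refine ⟨BCol.decidableInPolyTime_hasExtension, fun G S' c' hG hS hp => ?_⟩
  rw [BCol.exists_isPerfectMatching_auxGraph_iff]
  exact BCol.hasBPrecolouringExtension_iff_bijective hG hS hp
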